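/- Work over $\mathbb{C}$. For integers $m,n\ge 0$ put $V=\mathbb{C}^{m+1}$, $W=\mathbb{C}^{n+1}$, and let $X_{m,n}\subset\mathbb{P}(V\otimes S_2(W))=\mathbb{P}^N$, $N=(m+1)\binom{n+2}{2}-1$, be the Segre-Veronese variety, i.e. the image of $\mathbb{P}^m\times\mathbb{P}^n$ under the embedding $([u],[v])\mapsto[u\otimes v^2]$ given by $\mathcal{O}(1,2)$. For $p=[u\otimes v^2]\in X_{m,n}$ let $T_p=V\otimes v^2+u\otimes vW\subset V\otimes S_2(W)$ be the affine cone over the tangent space to $X_{m,n}$ at $p$. For $s\ge 0$, say that $T(m,n;1,2;s)$ holds if, for general points $p_1,\dots,p_s\in X_{m,n}$, $$\dim\sum_{i=1}^s T_{p_i}=\min\left\{s(m+n+1),\ (m+1)\binom{n+2}{2}\right\}.$$ Let $\sigma_s(X_{m,n})$ be the $s$-th secant variety, i.e. the Zariski closure in $\mathbb{P}^N$ of the union of the linear spans of all $s$-tuples of points of $X_{m,n}$ (empty, of dimension $-1$, when $s=0$). It is called defective if $\dim\sigma_s(X_{m,n})\ne\min\{N,\ s(m+n+1)-1\}$. Then: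 1. For all $n,s\ge 0$, $T(2,n;1,2;s)$ holds if and only if there is no integer $k\ge 1$ with $(n,s)=(2k+1,3k+2)$. 2. For all $n,s\ge 0$, $\sigma_s(X_{2,n})$ is defective if and only if $(n,s)=(2k+1,3k+2)$ for some integer $k\ge 1$. 3. For all $n,s\ge 0$, $\sigma_s(X_{1,n})$ is not defective. -/

import Mathlib

open scoped LinearAlgebra.Projectivization

noncomputable section

namespace SegreVeronese

/-! ### Projective algebraic geometry over `ℂ` -/

/-- Zariski closure of a subset `S` of the projective space of `ι → ℂ`: the common zeros of all
homogeneous polynomials that vanish on `S`.  (Vanishing of a homogeneous polynomial at a point does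
not depend on the representative.) -/
def zariskiClosure {ι : Type} (S : Set (ℙ ℂ (ι → ℂ))) : Set (ℙ ℂ (ι → ℂ)) :=
  {x | ∀ (F : MvPolynomial ι ℂ) (d : ℕ), F.IsHomogeneous d →
    (∀ y ∈ S, MvPolynomial.eval y.rep F = 0) → MvPolynomial.eval x.rep F = 0}

/-- The affine cone over a subset of projective space (it always contains the origin). -/
def affineCone {ι : Type} (Y : Set (ℙ ℂ (ι → ℂ))) : Set (ι → ℂ) :=
  {x | x = 0 ∨ ∃ hx : x ≠ 0, Projectivization.mk ℂ x hx ∈ Y}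

/-- The homogeneous coordinate ring of `Y`: polynomials modulo those vanishing on the affine cone
over `Y`. -/
abbrev HomogCoordRing {ι : Type} (Y : Set (ℙ ℂ (ι → ℂ))) : Type :=
  MvPolynomial ι ℂ ⧸ MvPolynomial.vanishingIdeal ℂ (affineCone Y)

/-- `Y` has dimension `d` as a projective algebraic set: its homogeneous coordinate ring has
Krull dimension `d + 1`.  The empty set has dimension `-1`. -/
def HasDim {ι : Type} (Y : Set (ℙ ℂ (ι → ℂ))) (d : ℤ) : Prop :=
  ∃ c : ℕ, ringKrullDim (HomogCoordRing Y) = c ∧ d = (c : ℤ) - 1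

/-- The `s`-th secant variety of `X`: Zariski closure of the union of the linear spans of all
`s`-tuples of points of `X`. -/
def secantVariety {ι : Type} (s : ℕ) (X : Set (ℙ ℂ (ι → ℂ))) : Set (ℙ ℂ (ι → ℂ)) :=
  zariskiClosure {x | ∃ p : Fin s → ℙ ℂ (ι → ℂ),
    (∀ i, p i ∈ X) ∧ x.submodule ≤ ⨆ i, (p i).submodule}

/-! ### The Segre-Veronese variety of bidegree `(1, 2)`

`S₂(W)` with `W = ℂ^{n+1}` is modelled by `Sym2 (Fin (n+1)) → ℂ` (symmetric matrices), and
`V ⊗ S₂(W)` with `V = ℂ^{m+1}` by functions on `Fin (m+1) × Sym2 (Fin (n+1))`. -/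

/-- Index set of the coordinates of `V ⊗ S₂(W)`. -/
abbrev Idx (m n : ℕ) : Type := Fin (m + 1) × Sym2 (Fin (n + 1))

/-- The symmetric product `v w ∈ S₂(W)` of two vectors `v, w ∈ W`. -/
def symMul {n : ℕ} (v w : Fin (n + 1) → ℂ) : Sym2 (Fin (n + 1)) → ℂ :=
  Sym2.lift ⟨fun j k => (v j * w k + v k * w j) / 2, fun j k => by ring⟩

/-- The tensor `a ⊗ q ∈ V ⊗ S₂(W)`. -/
def tens {m n : ℕ} (a : Fin (m + 1) → ℂ) (q : Sym2 (Fin (n + 1)) → ℂ) : Idx m n → ℂ :=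
  fun x => a x.1 * q x.2

/-- The coordinates of `v²` are all the quadratic monomials in `v`. -/
theorem symMul_self {n : ℕ} (v : Fin (n + 1) → ℂ) (j k : Fin (n + 1)) :
    symMul v v s(j, k) = v j * v k := by
  simp only [symMul, Sym2.lift_mk]
  ring

theorem tens_ne_zero {m n : ℕ} {u : Fin (m + 1) → ℂ} {v : Fin (n + 1) → ℂ}
    (hu : u ≠ 0) (hv : v ≠ 0) : tens u (symMul v v) ≠ 0 := by
  obtain ⟨i, hi⟩ := Function.ne_iff.mp hu
  obtain ⟨j, hj⟩ := Function.ne_iff.mp hv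
  refine Function.ne_iff.mpr ⟨(i, s(j, j)), ?_⟩
  simp only [tens, symMul_self]
  exact mul_ne_zero hi (mul_ne_zero hj hj)

/-- The Segre-Veronese variety `X_{m,n}`: the image of `ℙ^m × ℙ^n` under the embedding
`([u], [v]) ↦ [u ⊗ v²]` given by `𝒪(1,2)`. -/
def X (m n : ℕ) : Set (ℙ ℂ (Idx m n → ℂ)) :=
  {x | ∃ (u : Fin (m + 1) → ℂ) (v : Fin (n + 1) → ℂ) (hu : u ≠ 0) (hv : v ≠ 0),
    x = Projectivization.mk ℂ (tens u (symMul v v)) (tens_ne_zero hu hv)}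

/-- The expected dimension `min {N, s (dim X + 1) - 1}` of the `s`-th secant variety of
`X_{m,n} ⊆ ℙ^N`, where `N + 1 = (m+1) * binom(n+2, 2)` and `dim X = m + n`. -/
def expectedDim (m n s : ℕ) : ℤ :=
  min (((m + 1) * (n + 2).choose 2 : ℕ) - 1 : ℤ) ((s * (m + n + 1) : ℕ) - 1 : ℤ)

/-- The `s`-th secant variety of `X_{m,n}` is defective: it does not have the expected
dimension. -/
def IsDefective (m n s : ℕ) : Prop :=
  ¬ HasDim (secantVariety s (X m n)) (expectedDim m n s)

/-! ### The statement `T(m,n;1,2;s)` -/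

/-- The affine cone `T_p = V ⊗ v² + u ⊗ vW` over the tangent space to `X_{m,n}` at
`p = [u ⊗ v²]`. -/
def tangentCone {m n : ℕ} (u : Fin (m + 1) → ℂ) (v : Fin (n + 1) → ℂ) :
    Submodule ℂ (Idx m n → ℂ) :=
  Submodule.span ℂ (Set.range fun a : Fin (m + 1) → ℂ => tens a (symMul v v)) ⊔
    Submodule.span ℂ (Set.range fun w : Fin (n + 1) → ℂ => tens u (symMul v w))

/-- `P` holds for `s` general points `([u_i], [v_i])` of `ℙ^m × ℙ^n`: it holds for all tuples of
representatives outside the zero locus of some nonzero polynomial. -/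
def ForGeneralPoints (m n s : ℕ)
    (P : (Fin s → Fin (m + 1) → ℂ) → (Fin s → Fin (n + 1) → ℂ) → Prop) : Prop :=
  ∃ F : MvPolynomial (Fin s × (Fin (m + 1) ⊕ Fin (n + 1))) ℂ, F ≠ 0 ∧
    ∀ (u : Fin s → Fin (m + 1) → ℂ) (v : Fin s → Fin (n + 1) → ℂ),
      (∀ i, u i ≠ 0) → (∀ i, v i ≠ 0) →
      MvPolynomial.eval (fun x => Sum.elim (u x.1) (v x.1) x.2) F ≠ 0 → P u v

/-- `T(m,n;1,2;s)`: for general points `p_1, …, p_s` of `X_{m,n}`, the span of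
`T_{p_1}, …, T_{p_s}` has the expected dimension
`min {s (m+n+1), (m+1) * binom(n+2, 2)}`. -/
def T (m n s : ℕ) : Prop :=
  ForGeneralPoints m n s fun u v =>
    Module.finrank ℂ ↥(⨆ i, tangentCone (u i) (v i)) =
      min (s * (m + n + 1)) ((m + 1) * (n + 2).choose 2)

end SegreVeronese

end

noncomputable section

namespace SegreVeronese

/-! ### Krull dimension and transcendence degree -/

/-! Terracini's lemma turns the dimension of a secant variety into a rank. The cone over it is
parametrised by `∑ uᵢ ⊗ vᵢ²`, and the Jacobian of this parametrisation has the sum of the tangent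
cones as row span (`span_jacobian`). The Jacobian criterion bounds the dimension below by this rank;
counting parameters and coordinates bounds it above. Hence `T` implies non-defectivity, and by
semicontinuity of rank `T` can be tested at one configuration (`T_of_exists`).

For `m = 2` the exceptional cases come from a Koszul flattening `V ⊗ W* → ⋀²V ⊗ W`. It has rank at
most 2 on `u ⊗ v²`, hence at most `2s` on a sum of `s` such tensors. For `n = 2k+1`, `s = 3k+2` this
is less than its size `3(2k+2)`, so its determinant, which is not identically zero
(`det_koszulWitness_ne_zero`), vanishes on a secant variety that was expected to fill the space.

All other cases with `m = 2` follow by induction from `n` to `n + 2`, adding three points outside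
`ℂ^{n+1}`. A functional killing all tangent cones is restricted to `V ⊗ S₂(ℂ^{n+1})`. If the
restriction is zero, the functional is determined by three linear forms on `ℂ^{n+1}` subject to
explicit linear conditions (`extension_kernel`), whose rank is computed at special points
(`extCorankLE_even`, `extCorankLE_odd`, `extCorankLE_odd_one`). Coranks therefore add
(`TangentCorankLE.step`). This yields independent tangent cones at one value of `s` and spanning
ones at a slightly larger value, and monotonicity in `s` does the rest (`T_two`). For `m = 1` the `n
+ 1` coordinate points are at once independent and spanning (`T_one`). -/

theorem ringKrullDim_eq_of_isIntegral (A B : Type*) [CommRing A] [CommRing B] [Algebra A B]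
    [FaithfulSMul A B] [Algebra.IsIntegral A B] : ringKrullDim B = ringKrullDim A := by
  refine le_antisymm ?_ ?_
  -- Incomparability makes contraction of primes strictly monotone; the other inequality is lying
  -- over followed by going up.
  · refine Order.krullDim_le_of_strictMono (PrimeSpectrum.comap (algebraMap A B)) ?_
    intro p q hpq
    exact Ideal.IsIntegral.comap_lt_comap (R := A) (I := p.asIdeal) (J := q.asIdeal) hpq
  · refine iSup_le fun l => ?_
    obtain ⟨P, hP, hP'⟩ := Ideal.nonempty_primesOver (R := A) (S := B) (RelSeries.head l).asIdeal
    obtain ⟨L, hL, -⟩ := Ideal.exists_ltSeries_of_hasGoingUp (S := B) l P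
    rw [← hL]
    exact le_iSup (fun l : LTSeries (PrimeSpectrum B) => (l.length : WithBot ℕ∞)) L

/-- The Krull dimension of a finitely generated domain over a field is its transcendence degree. -/
theorem exists_ringKrullDim_eq_trdeg (k A : Type) [Field k] [CommRing A] [IsDomain A] [Algebra k A]
    [Algebra.FiniteType k A] :
    ∃ d : ℕ, ringKrullDim A = d ∧ Algebra.trdeg k A = d := by
  obtain ⟨d, g, hg, hint⟩ := exists_integral_inj_algHom_of_fg k A
  refine ⟨d, ?_, ?_⟩
  · algebraize [g.toRingHom]
    have : FaithfulSMul (MvPolynomial (Fin d) k) A := (faithfulSMul_iff_algebraMap_injective _ _).2 hg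
    rw [ringKrullDim_eq_of_isIntegral (MvPolynomial (Fin d) k) A,
      MvPolynomial.ringKrullDim_of_isNoetherianRing]
    simp
  · algebraize [g.toRingHom]
    have : FaithfulSMul (MvPolynomial (Fin d) k) A := (faithfulSMul_iff_algebraMap_injective _ _).2 hg
    have : IsScalarTower k (MvPolynomial (Fin d) k) A :=
      IsScalarTower.of_algebraMap_eq fun x => (g.commutes x).symm
    have h := trdeg_add_eq k (MvPolynomial (Fin d) k) (A := A)
    have : Algebra.IsAlgebraic (MvPolynomial (Fin d) k) A := inferInstance
    rw [trdeg_eq_zero (R := MvPolynomial (Fin d) k), add_zero] at h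
    rw [← h, MvPolynomial.trdeg_of_isDomain]
    simp

theorem ringKrullDim_le_of_injective {A τ : Type} [CommRing A] [Algebra ℂ A] [Algebra.FiniteType ℂ A]
    [Fintype τ] (f : A →ₐ[ℂ] MvPolynomial τ ℂ) (hf : Function.Injective f) :
    ringKrullDim A ≤ Fintype.card τ := by
  have : IsDomain A := hf.isDomain f.toRingHom
  obtain ⟨d, hd, hd'⟩ := exists_ringKrullDim_eq_trdeg ℂ A
  have h := trdeg_le_of_injective f hf
  rw [hd', MvPolynomial.trdeg_of_isDomain] at h
  simp only [Cardinal.mk_fintype, Cardinal.lift_natCast, Nat.cast_le] at h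
  rw [hd]
  exact_mod_cast h

theorem card_le_ringKrullDim {A κ : Type} [CommRing A] [IsDomain A] [Algebra ℂ A]
    [Algebra.FiniteType ℂ A] [Fintype κ] (x : κ → A) (hx : AlgebraicIndependent ℂ x) :
    (Fintype.card κ : WithBot ℕ∞) ≤ ringKrullDim A := by
  obtain ⟨d, hd, hd'⟩ := exists_ringKrullDim_eq_trdeg ℂ A
  have h := hx.cardinalMk_le_trdeg
  rw [hd'] at h
  simp only [Cardinal.mk_fintype, Nat.cast_le] at h
  rw [hd]
  exact_mod_cast h

/-! ### Ranks of matrices of polynomials -/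

open MvPolynomial in
/-- If the rows of a matrix of polynomials are independent at one point, then some
matrix makes it square with determinant nonzero at that point. -/
theorem exists_det_mul_ne_zero {ρ κ τ : Type} [Fintype ρ] [DecidableEq ρ] [Fintype κ]
    (M : Matrix ρ κ (MvPolynomial τ ℂ)) (x₀ : τ → ℂ)
    (h : LinearIndependent ℂ (M.map (eval x₀)).row) :
    ∃ B : Matrix κ ρ (MvPolynomial τ ℂ), eval x₀ (M * B).det ≠ 0 := by
  set A := M.map (eval x₀) with hA
  -- Constant entries suffice: over `ℂ` the Gram matrix `A * Aᴴ` has the rank of `A`, so it is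
  -- invertible when the rows of `A` are independent.
  let B : Matrix κ ρ (MvPolynomial τ ℂ) := A.conjTranspose.map C
  refine ⟨B, ?_⟩
  have h1 : (M * B).map (eval x₀) = A * A.conjTranspose := by
    rw [Matrix.map_mul, ← hA, Matrix.map_map]
    congr 1
    ext i j
    simp
  have h2 := RingHom.map_det (eval x₀) (M * B)
  rw [RingHom.mapMatrix_apply] at h2
  rw [h2, h1]
  have h3 : (A * A.conjTranspose).rank = Fintype.card ρ := by
    open ComplexOrder in rw [Matrix.rank_self_mul_conjTranspose, h.rank_matrix]
  have h4 : LinearIndependent ℂ (A * A.conjTranspose).row := by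
    rw [linearIndependent_iff_card_eq_finrank_span, ← h3, Matrix.rank_eq_finrank_span_row]
    rfl
  have h5 := Matrix.linearIndependent_rows_iff_isUnit.1 h4
  rw [Matrix.isUnit_iff_isUnit_det] at h5
  exact h5.ne_zero

open MvPolynomial in
theorem linearIndependent_rows_of_det_mul_ne_zero {ρ κ τ : Type} [Fintype ρ] [DecidableEq ρ]
    [Fintype κ] (M : Matrix ρ κ (MvPolynomial τ ℂ)) (B : Matrix κ ρ (MvPolynomial τ ℂ)) (x : τ → ℂ)
    (h : eval x (M * B).det ≠ 0) : LinearIndependent ℂ (M.map (eval x)).row := by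
  have h2 := RingHom.map_det (eval x) (M * B)
  rw [RingHom.mapMatrix_apply, Matrix.map_mul] at h2
  rw [Fintype.linearIndependent_iff]
  intro g hg
  have h3 : Matrix.vecMul g (M.map (eval x)) = 0 := by
    ext k
    have := congrFun hg k
    simpa [Matrix.vecMul, dotProduct, Finset.sum_apply] using this
  have h4 := Matrix.eq_zero_of_vecMul_eq_zero (h2 ▸ h) (v := g)
    (by rw [← Matrix.vecMul_vecMul, h3, Matrix.zero_vecMul])
  exact fun i => congrFun h4 i

open MvPolynomial in
/-- Lower semicontinuity of the rank of a family of vectors depending polynomially on parameters. -/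
theorem exists_ne_zero_le_finrank_span {μ κ τ : Type} [Finite μ] [Fintype κ]
    (M : Matrix μ κ (MvPolynomial τ ℂ)) (x₀ : τ → ℂ) (r : ℕ)
    (h : r ≤ Module.finrank ℂ (Submodule.span ℂ (Set.range (M.map (eval x₀)).row))) :
    ∃ F : MvPolynomial τ ℂ, F ≠ 0 ∧ ∀ x, eval x F ≠ 0 →
      r ≤ Module.finrank ℂ (Submodule.span ℂ (Set.range (M.map (eval x)).row)) := by
  classical
  obtain ⟨ρ, a, ha, hspan, hli⟩ := exists_linearIndependent' ℂ (M.map (eval x₀)).row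
  have : Finite ρ := Finite.of_injective a ha
  have := Fintype.ofFinite ρ
  obtain ⟨B, hB⟩ := exists_det_mul_ne_zero (M.submatrix a id) x₀ hli
  refine ⟨(M.submatrix a id * B).det, fun h0 => hB (by rw [h0, map_zero]), fun x hx => ?_⟩
  have h1 := linearIndependent_rows_of_det_mul_ne_zero _ B x hx
  have h2 := finrank_span_eq_card hli
  rw [hspan] at h2
  have h3 := finrank_span_eq_card h1
  calc r ≤ _ := h
    _ = _ := h2
    _ = _ := h3.symm
    _ ≤ _ := Submodule.finrank_mono (Submodule.span_mono (by
      rintro _ ⟨i, rfl⟩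
      exact ⟨a i, rfl⟩))

/-! ### The Jacobian criterion -/

open MvPolynomial in
theorem pderiv_aeval {ι τ : Type} [Fintype ι] (g : ι → MvPolynomial τ ℂ) (P : MvPolynomial ι ℂ)
    (t : τ) : pderiv t (aeval g P) = ∑ i, aeval g (pderiv i P) * pderiv t (g i) := by
  classical
  induction P using MvPolynomial.induction_on with
  | C a => simp [algebraMap_eq]
  | add p q hp hq => simp only [map_add, hp, hq, add_mul, Finset.sum_add_distrib]
  | mul_X p i hp =>
    simp only [map_mul, aeval_X, pderiv_mul, hp, map_add, add_mul, Finset.sum_add_distrib, pderiv_X]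
    congr 1
    · rw [Finset.sum_mul]
      exact Finset.sum_congr rfl fun j _ => by ring
    · rw [Finset.sum_eq_single i]
      · simp
      · intro j _ hj
        simp [hj.symm]
      · simp

open MvPolynomial in
theorem totalDegree_pderiv_lt {ι : Type} (P : MvPolynomial ι ℂ) (i : ι) (h : pderiv i P ≠ 0) :
    (pderiv i P).totalDegree < P.totalDegree := by
  obtain ⟨m, hm, hdeg⟩ := Finset.exists_mem_eq_sup (pderiv i P).support (support_nonempty.2 h)
    (fun m : ι →₀ ℕ => m.sum fun _ e => e)
  rw [totalDegree, hdeg]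
  rw [mem_support_iff, coeff_pderiv] at hm
  have h2 := le_totalDegree (mem_support_iff.2 (left_ne_zero_of_mul hm))
  rw [Finsupp.sum_add_index' (fun _ => rfl) (fun _ _ _ => rfl)] at h2
  simp only [Finsupp.sum_single_index] at h2
  omega

open MvPolynomial in
-- Characteristic zero enters here: a coefficient of `P` at a monomial `m` with `m i ≠ 0` reappears
-- in the `i`-th derivative multiplied by `m i`.
theorem eq_C_of_pderiv_eq_zero {ι : Type} (P : MvPolynomial ι ℂ) (h : ∀ i, pderiv i P = 0) :
    P = C (coeff 0 P) := by
  classical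
  ext m
  rw [coeff_C]
  split_ifs with hm
  · rw [hm]
  · obtain ⟨i, hi⟩ : ∃ i, m i ≠ 0 := by
      by_contra! hc
      exact hm (Finsupp.ext fun i => (hc i).symm)
    have h1 := congrArg (coeff (m - Finsupp.single i 1)) (h i)
    rw [coeff_pderiv, coeff_zero] at h1
    have h2 : m - Finsupp.single i 1 + Finsupp.single i 1 = m :=
      tsub_add_cancel_of_le (Finsupp.single_le_iff.2 (Nat.one_le_iff_ne_zero.2 hi))
    rw [h2] at h1
    rcases mul_eq_zero.1 h1 with h1 | h1
    · exact h1
    · exact absurd h1 (Nat.cast_add_one_ne_zero _)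

open MvPolynomial in
/-- **Jacobian criterion**: polynomials whose differentials are independent at one point are
algebraically independent. -/
theorem algebraicIndependent_of_jacobian {ι τ : Type} [Fintype ι] [Fintype τ]
    (g : ι → MvPolynomial τ ℂ) (x₀ : τ → ℂ)
    (h : LinearIndependent ℂ ((Matrix.of fun i t => pderiv t (g i)).map (eval x₀)).row) :
    AlgebraicIndependent ℂ g := by
  classical
  obtain ⟨B, hB⟩ := exists_det_mul_ne_zero _ x₀ h
  have hB' : ((Matrix.of fun i t => pderiv t (g i)) * B).det ≠ 0 := fun h0 => hB (by rw [h0, map_zero])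
  have key : ∀ d : ℕ, ∀ P : MvPolynomial ι ℂ, P.totalDegree ≤ d → aeval g P = 0 → P = 0 := by
    intro d
    induction d using Nat.strong_induction_on with
    | _ d ih =>
      intro P hP h0
      -- Differentiating the relation `P(g) = 0` shows that this vector is killed by the Jacobian,
      -- hence is zero. So every partial derivative of `P` is again a relation, of smaller degree.
      have h1 : (fun i => aeval g (pderiv i P)) = 0 := by
        refine Matrix.eq_zero_of_vecMul_eq_zero hB' ?_
        rw [← Matrix.vecMul_vecMul]
        have : Matrix.vecMul (fun i => aeval g (pderiv i P))
            (Matrix.of fun i t => pderiv t (g i)) = 0 := by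
          ext1 t
          have := pderiv_aeval g P t
          rw [h0, map_zero] at this
          simpa [Matrix.vecMul, dotProduct] using this.symm
        rw [this, Matrix.zero_vecMul]
      have h2 : ∀ i, pderiv i P = 0 := by
        intro i
        by_contra hne
        exact hne (ih _ ((totalDegree_pderiv_lt P i hne).trans_le hP) _ le_rfl (congrFun h1 i))
      rw [eq_C_of_pderiv_eq_zero P h2] at h0 ⊢
      simpa using h0
  exact (injective_iff_map_eq_zero _).2 fun P hP => key _ P le_rfl hP

open MvPolynomial in
/-- The rank of the Jacobian matrix of a parametrisation is a lower bound for the dimension of a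
set whose ideal is contained in the ideal of the image. -/
theorem finrank_jacobian_le_ringKrullDim {ι τ : Type} [Fintype ι] [Fintype τ]
    (f : ι → MvPolynomial τ ℂ) (I : Ideal (MvPolynomial ι ℂ)) (hI : I ≤ RingHom.ker (aeval f (R := ℂ)))
    (x₀ : τ → ℂ) :
    (Module.finrank ℂ (Submodule.span ℂ (Set.range
      ((Matrix.of fun t i => pderiv t (f i)).map (eval x₀)).row)) : WithBot ℕ∞) ≤
      ringKrullDim (MvPolynomial ι ℂ ⧸ I) := by
  set J : Matrix ι τ (MvPolynomial τ ℂ) := Matrix.of fun i t => pderiv t (f i)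
  have h1 : Module.finrank ℂ (Submodule.span ℂ (Set.range
      ((Matrix.of fun t i => pderiv t (f i)).map (eval x₀)).row)) =
      Module.finrank ℂ (Submodule.span ℂ (Set.range (J.map (eval x₀)).row)) := by
    rw [← Matrix.rank_eq_finrank_span_row, ← Matrix.rank_eq_finrank_span_row, ← Matrix.rank_transpose]
    rfl
  rw [h1]
  obtain ⟨ρ, a, ha, hspan, hli⟩ := exists_linearIndependent' ℂ (J.map (eval x₀)).row
  have : Finite ρ := Finite.of_injective a ha
  have := Fintype.ofFinite ρ
  rw [← hspan, finrank_span_eq_card hli]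
  -- As many coordinates as the rank are algebraically independent in the image of `aeval f`, a
  -- quotient of the ring modulo `I`.
  have h2 : AlgebraicIndependent ℂ (f ∘ a) := algebraicIndependent_of_jacobian (f ∘ a) x₀ hli
  let y : ρ → (aeval f (R := ℂ)).range := fun i => ⟨f (a i), MvPolynomial.X (a i), aeval_X f (a i)⟩
  have h3 : AlgebraicIndependent ℂ y :=
    AlgebraicIndependent.of_comp (aeval f (R := ℂ)).range.val (by exact h2)
  have : Algebra.FiniteType ℂ (aeval f (R := ℂ)).range :=
    Algebra.FiniteType.of_surjective (aeval f (R := ℂ)).rangeRestrict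
      (AlgHom.rangeRestrict_surjective _)
  refine (card_le_ringKrullDim y h3).trans ?_
  refine ringKrullDim_le_of_surjective
    (Ideal.Quotient.lift I (aeval f (R := ℂ)).rangeRestrict.toRingHom fun p hp => ?_) ?_
  · have := hI hp
    exact Subtype.ext this
  · exact Ideal.Quotient.lift_surjective_of_surjective _ _ (AlgHom.rangeRestrict_surjective _)

open MvPolynomial in
/-- The number of parameters is an upper bound for the dimension. -/
theorem ringKrullDim_le_card_of_ker_le {ι τ : Type} [Fintype ι] [Fintype τ]
    (f : ι → MvPolynomial τ ℂ) (I : Ideal (MvPolynomial ι ℂ))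
    (hI : RingHom.ker (aeval f (R := ℂ)) ≤ I) :
    ringKrullDim (MvPolynomial ι ℂ ⧸ I) ≤ Fintype.card τ := by
  refine le_trans (ringKrullDim_le_of_surjective (Ideal.Quotient.factor hI)
    (Ideal.Quotient.factor_surjective hI)) ?_
  exact ringKrullDim_le_of_injective (Ideal.kerLiftAlg (aeval f (R := ℂ)))
    (Ideal.kerLiftAlg_injective _)

/-! ### Bilinearity of the tensors -/

theorem symMul_comm {n : ℕ} (v w : Fin (n + 1) → ℂ) : symMul v w = symMul w v := by
  ext x
  induction x using Sym2.inductionOn with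
  | hf j k => simp only [symMul, Sym2.lift_mk]; ring

theorem symMul_add_right {n : ℕ} (v w w' : Fin (n + 1) → ℂ) :
    symMul v (w + w') = symMul v w + symMul v w' := by
  ext x
  induction x using Sym2.inductionOn with
  | hf j k => simp only [symMul, Sym2.lift_mk, Pi.add_apply]; ring

theorem symMul_smul_right {n : ℕ} (c : ℂ) (v w : Fin (n + 1) → ℂ) :
    symMul v (c • w) = c • symMul v w := by
  ext x
  induction x using Sym2.inductionOn with
  | hf j k => simp only [symMul, Sym2.lift_mk, Pi.smul_apply, smul_eq_mul]; ring

theorem symMul_smul_left {n : ℕ} (c : ℂ) (v w : Fin (n + 1) → ℂ) :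
    symMul (c • v) w = c • symMul v w := by
  rw [symMul_comm, symMul_smul_right, symMul_comm]

theorem symMul_add_left {n : ℕ} (v v' w : Fin (n + 1) → ℂ) :
    symMul (v + v') w = symMul v w + symMul v' w := by
  rw [symMul_comm, symMul_add_right, symMul_comm w v, symMul_comm w v']

theorem tens_add_right {m n : ℕ} (a : Fin (m + 1) → ℂ) (q q' : Sym2 (Fin (n + 1)) → ℂ) :
    tens a (q + q') = tens a q + tens a q' := by
  ext x; simp only [tens, Pi.add_apply]; ring

theorem tens_smul_right {m n : ℕ} (c : ℂ) (a : Fin (m + 1) → ℂ) (q : Sym2 (Fin (n + 1)) → ℂ) :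
    tens a (c • q) = c • tens a q := by
  ext x; simp only [tens, Pi.smul_apply, smul_eq_mul]; ring

theorem tens_add_left {m n : ℕ} (a a' : Fin (m + 1) → ℂ) (q : Sym2 (Fin (n + 1)) → ℂ) :
    tens (a + a') q = tens a q + tens a' q := by
  ext x; simp only [tens, Pi.add_apply]; ring

theorem tens_smul_left {m n : ℕ} (c : ℂ) (a : Fin (m + 1) → ℂ) (q : Sym2 (Fin (n + 1)) → ℂ) :
    tens (c • a) q = c • tens a q := by
  ext x; simp only [tens, Pi.smul_apply, smul_eq_mul]; ring

/-- The symmetric product as a bilinear map. -/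
def symMulHom (n : ℕ) :
    (Fin (n + 1) → ℂ) →ₗ[ℂ] (Fin (n + 1) → ℂ) →ₗ[ℂ] (Sym2 (Fin (n + 1)) → ℂ) :=
  LinearMap.mk₂ ℂ symMul symMul_add_left symMul_smul_left symMul_add_right symMul_smul_right

/-- The tensor product as a bilinear map. -/
def tensHom (m n : ℕ) :
    (Fin (m + 1) → ℂ) →ₗ[ℂ] (Sym2 (Fin (n + 1)) → ℂ) →ₗ[ℂ] (Idx m n → ℂ) :=
  LinearMap.mk₂ ℂ tens tens_add_left tens_smul_left tens_add_right tens_smul_right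

@[simp] theorem symMulHom_apply {n : ℕ} (v w : Fin (n + 1) → ℂ) : symMulHom n v w = symMul v w := rfl

@[simp] theorem tensHom_apply {m n : ℕ} (a : Fin (m + 1) → ℂ) (q : Sym2 (Fin (n + 1)) → ℂ) :
    tensHom m n a q = tens a q := rfl

/-! ### The parametrisation of the cone over the secant variety -/

/-- Parameters: the coordinates of `s` points of `V × W`. -/
abbrev Param (m n s : ℕ) : Type := Fin s × (Fin (m + 1) ⊕ Fin (n + 1))

/-- The parameter point with given coordinates. -/
def paramPoint {m n s : ℕ} (u : Fin s → Fin (m + 1) → ℂ) (v : Fin s → Fin (n + 1) → ℂ) :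
    Param m n s → ℂ := fun x => Sum.elim (u x.1) (v x.1) x.2

/-- The coordinates of `∑ uᵢ ⊗ vᵢ²` as polynomials. -/
def secantParam (m n s : ℕ) (x : Idx m n) : MvPolynomial (Param m n s) ℂ :=
  ∑ i, MvPolynomial.X (i, Sum.inl x.1) *
    Sym2.lift ⟨fun j k => MvPolynomial.X (i, Sum.inr j) * MvPolynomial.X (i, Sum.inr k),
      fun _ _ => mul_comm _ _⟩ x.2

theorem eval_secantParam {m n s : ℕ} (u : Fin s → Fin (m + 1) → ℂ) (v : Fin s → Fin (n + 1) → ℂ) :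
    (fun x => MvPolynomial.eval (paramPoint u v) (secantParam m n s x)) =
      ∑ i, tens (u i) (symMul (v i) (v i)) := by
  ext ⟨a, q⟩
  induction q using Sym2.inductionOn with
  | hf j k => simp [secantParam, paramPoint, tens, symMul_self]

theorem eval_pderiv_inl {m n s : ℕ} (u : Fin s → Fin (m + 1) → ℂ) (v : Fin s → Fin (n + 1) → ℂ)
    (i : Fin s) (a : Fin (m + 1)) (x : Idx m n) :
    MvPolynomial.eval (paramPoint u v) (MvPolynomial.pderiv (i, Sum.inl a) (secantParam m n s x)) =
      tens (Pi.single a 1) (symMul (v i) (v i)) x := by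
  obtain ⟨b, q⟩ := x
  induction q using Sym2.inductionOn with
  | hf j k =>
    simp only [secantParam, Sym2.lift_mk, map_sum, MvPolynomial.pderiv_mul, MvPolynomial.pderiv_X,
      map_add, map_mul, MvPolynomial.eval_X, paramPoint, tens, symMul_self]
    rw [Finset.sum_eq_single i]
    · by_cases hab : b = a
      · subst hab; simp
      · simp [hab]
    · intro l _ hl
      simp [hl]
    · simp

theorem eval_pderiv_inr {m n s : ℕ} (u : Fin s → Fin (m + 1) → ℂ) (v : Fin s → Fin (n + 1) → ℂ)
    (i : Fin s) (l : Fin (n + 1)) (x : Idx m n) :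
    MvPolynomial.eval (paramPoint u v) (MvPolynomial.pderiv (i, Sum.inr l) (secantParam m n s x)) =
      2 * tens (u i) (symMul (v i) (Pi.single l 1)) x := by
  obtain ⟨b, q⟩ := x
  induction q using Sym2.inductionOn with
  | hf j k =>
    simp only [secantParam, Sym2.lift_mk, map_sum, MvPolynomial.pderiv_mul, MvPolynomial.pderiv_X,
      map_add, map_mul, MvPolynomial.eval_X, paramPoint, tens, symMul]
    rw [Finset.sum_eq_single i]
    · by_cases hj : j = l <;> by_cases hk : k = l <;> simp [hj, hk] <;> ring
    · intro l _ hl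
      simp [hl]
    · simp

/-- The rows of the (transposed) Jacobian matrix of the parametrisation. -/
def jacobian (m n s : ℕ) : Matrix (Param m n s) (Idx m n) (MvPolynomial (Param m n s) ℂ) :=
  Matrix.of fun t x => MvPolynomial.pderiv t (secantParam m n s x)

theorem row_jacobian_inl {m n s : ℕ} (u : Fin s → Fin (m + 1) → ℂ) (v : Fin s → Fin (n + 1) → ℂ)
    (i : Fin s) (a : Fin (m + 1)) :
    ((jacobian m n s).map (MvPolynomial.eval (paramPoint u v))).row (i, Sum.inl a) =
      tens (Pi.single a 1) (symMul (v i) (v i)) :=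
  funext fun x => eval_pderiv_inl u v i a x

theorem row_jacobian_inr {m n s : ℕ} (u : Fin s → Fin (m + 1) → ℂ) (v : Fin s → Fin (n + 1) → ℂ)
    (i : Fin s) (l : Fin (n + 1)) :
    ((jacobian m n s).map (MvPolynomial.eval (paramPoint u v))).row (i, Sum.inr l) =
      (2 : ℂ) • tens (u i) (symMul (v i) (Pi.single l 1)) :=
  funext fun x => eval_pderiv_inr u v i l x

theorem pi_mem_span_of_linear {ι E : Type} [Fintype ι] [DecidableEq ι] [AddCommGroup E] [Module ℂ E]
    (S : Submodule ℂ E) (f : (ι → ℂ) →ₗ[ℂ] E) (h : ∀ i, f (Pi.single i 1) ∈ S) (a : ι → ℂ) :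
    f a ∈ S := by
  rw [pi_eq_sum_univ' a, map_sum]
  exact S.sum_mem fun i _ => by
    rw [map_smul]
    exact S.smul_mem _ (by simpa [Pi.single_apply, eq_comm] using h i)

/-- The infinitesimal form of Terracini's lemma: derivatives in the coordinates of `uᵢ` give `V ⊗
vᵢ²`, those in the coordinates of `vᵢ` give `uᵢ ⊗ vᵢW`. -/
theorem span_jacobian {m n s : ℕ} (u : Fin s → Fin (m + 1) → ℂ) (v : Fin s → Fin (n + 1) → ℂ) :
    Submodule.span ℂ (Set.range ((jacobian m n s).map (MvPolynomial.eval (paramPoint u v))).row) =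
      ⨆ i, tangentCone (u i) (v i) := by
  apply le_antisymm
  · rw [Submodule.span_le]
    rintro _ ⟨⟨i, a | l⟩, rfl⟩
    · rw [row_jacobian_inl]
      exact Submodule.mem_iSup_of_mem i
        (Submodule.mem_sup_left (Submodule.subset_span ⟨Pi.single a 1, rfl⟩))
    · rw [row_jacobian_inr]
      exact Submodule.smul_mem _ _ (Submodule.mem_iSup_of_mem i
        (Submodule.mem_sup_right (Submodule.subset_span ⟨Pi.single l 1, rfl⟩)))
  · refine iSup_le fun i => sup_le ?_ ?_ <;> rw [Submodule.span_le]
    · rintro _ ⟨a, rfl⟩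
      refine pi_mem_span_of_linear _ ((tensHom m n).flip (symMul (v i) (v i))) (fun b => ?_) a
      refine Submodule.subset_span ⟨(i, Sum.inl b), ?_⟩
      rw [row_jacobian_inl]
      rfl
    · rintro _ ⟨w, rfl⟩
      refine pi_mem_span_of_linear _ (tensHom m n (u i) ∘ₗ symMulHom n (v i)) (fun l => ?_) w
      have h : (2 : ℂ) • tens (u i) (symMul (v i) (Pi.single l 1)) ∈ Submodule.span ℂ (Set.range
          ((jacobian m n s).map (MvPolynomial.eval (paramPoint u v))).row) := by
        rw [← row_jacobian_inr]
        exact Submodule.subset_span ⟨_, rfl⟩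
      -- This cancels the factor 2 produced by differentiating the square.
      have h2 := Submodule.smul_mem _ (2⁻¹ : ℂ) h
      rw [smul_smul, inv_mul_cancel₀ two_ne_zero, one_smul] at h2
      exact h2

theorem card_idx (m n : ℕ) : Fintype.card (Idx m n) = (m + 1) * (n + 2).choose 2 := by
  rw [Fintype.card_prod, Sym2.card, Fintype.card_fin, Fintype.card_fin]

/-- The summands have dimensions at most `m + 1` and `n + 1` and share the nonzero vector `u ⊗ v²`;
if `u` or `v` is zero, the second summand vanishes. -/
theorem finrank_tangentCone_le {m n : ℕ} (u : Fin (m + 1) → ℂ) (v : Fin (n + 1) → ℂ) :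
    Module.finrank ℂ (tangentCone u v) ≤ m + n + 1 := by
  set A := LinearMap.range ((tensHom m n).flip (symMul v v))
  set B := LinearMap.range (tensHom m n u ∘ₗ symMulHom n v)
  have h : tangentCone u v ≤ A ⊔ B := by
    refine sup_le_sup ?_ ?_ <;> rw [Submodule.span_le]
    · rintro _ ⟨a, rfl⟩; exact ⟨a, rfl⟩
    · rintro _ ⟨w, rfl⟩; exact ⟨w, rfl⟩
  have h0 := Submodule.finrank_mono h
  have h1 := Submodule.finrank_sup_add_finrank_inf_eq A B
  have hA : Module.finrank ℂ A ≤ m + 1 := (LinearMap.finrank_range_le _).trans (by simp)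
  have hB : Module.finrank ℂ B ≤ n + 1 := (LinearMap.finrank_range_le _).trans (by simp)
  by_cases huv : u = 0 ∨ v = 0
  · have hB0 : B = ⊥ := by
      rw [LinearMap.range_eq_bot]
      rcases huv with rfl | rfl <;> simp
    rw [hB0, finrank_bot] at h1
    rw [hB0] at h0
    omega
  · rw [not_or] at huv
    have hAB : 0 < Module.finrank ℂ (A ⊓ B : Submodule ℂ (Idx m n → ℂ)) := by
      have : A ⊓ B ≠ ⊥ := by
        rw [Submodule.ne_bot_iff]
        exact ⟨tens u (symMul v v), ⟨⟨u, rfl⟩, ⟨v, rfl⟩⟩, tens_ne_zero huv.1 huv.2⟩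
      exact Nat.pos_of_ne_zero fun h0 => this (Submodule.finrank_eq_zero.1 h0)
    omega

theorem finrank_iSup_le_sum {ι E : Type} [Fintype ι] [AddCommGroup E] [Module ℂ E]
    [FiniteDimensional ℂ E] (S : ι → Submodule ℂ E) (d : ℕ) (h : ∀ i, Module.finrank ℂ (S i) ≤ d) :
    Module.finrank ℂ (⨆ i, S i : Submodule ℂ E) ≤ Fintype.card ι * d := by
  classical
  have key : ∀ t : Finset ι, Module.finrank ℂ (t.sup S : Submodule ℂ E) ≤ t.card * d := by
    intro t
    induction t using Finset.induction_on with
    | empty => simp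
    | insert i t hi ih =>
      rw [Finset.sup_insert, Finset.card_insert_of_notMem hi, add_mul, one_mul]
      have := Submodule.finrank_add_le_finrank_add_finrank (S i) (t.sup S)
      have := h i
      omega
  have := key Finset.univ
  rwa [Finset.sup_univ_eq_iSup] at this

theorem finrank_iSup_tangentCone_le {m n s : ℕ} (u : Fin s → Fin (m + 1) → ℂ)
    (v : Fin s → Fin (n + 1) → ℂ) :
    Module.finrank ℂ ↥(⨆ i, tangentCone (u i) (v i)) ≤
      min (s * (m + n + 1)) ((m + 1) * (n + 2).choose 2) := by
  refine le_min ?_ ?_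
  · simpa using finrank_iSup_le_sum (fun i => tangentCone (u i) (v i)) (m + n + 1)
      fun i => finrank_tangentCone_le (u i) (v i)
  · refine (Submodule.finrank_le _).trans ?_
    rw [Module.finrank_fintype_fun_eq_card, card_idx]

/-- `T(m,n;1,2;s)` can be checked at one configuration of points. -/
theorem T_of_exists {m n s : ℕ} (u : Fin s → Fin (m + 1) → ℂ) (v : Fin s → Fin (n + 1) → ℂ)
    (h : min (s * (m + n + 1)) ((m + 1) * (n + 2).choose 2) ≤
      Module.finrank ℂ ↥(⨆ i, tangentCone (u i) (v i))) : T m n s := by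
  rw [← span_jacobian] at h
  obtain ⟨F, hF, hF'⟩ := exists_ne_zero_le_finrank_span (jacobian m n s) _ _ h
  refine ⟨F, hF, fun u v _ _ hx => le_antisymm (finrank_iSup_tangentCone_le u v) ?_⟩
  have := hF' (paramPoint u v) hx
  rwa [span_jacobian] at this

theorem exists_of_T {m n s : ℕ} (h : T m n s) :
    ∃ (u : Fin s → Fin (m + 1) → ℂ) (v : Fin s → Fin (n + 1) → ℂ),
      Module.finrank ℂ ↥(⨆ i, tangentCone (u i) (v i)) =
        min (s * (m + n + 1)) ((m + 1) * (n + 2).choose 2) := by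
  obtain ⟨F, hF, h⟩ := h
  -- The extra factor makes every coordinate nonzero, so the vectors `uᵢ` and `vᵢ` are nonzero as
  -- the genericity condition requires.
  have h2 : F * ∏ t, MvPolynomial.X t ≠ 0 :=
    mul_ne_zero hF (Finset.prod_ne_zero_iff.2 fun t _ => MvPolynomial.X_ne_zero t)
  obtain ⟨x, hx⟩ : ∃ x, MvPolynomial.eval x (F * ∏ t, MvPolynomial.X t) ≠ 0 := by
    by_contra! hc
    exact h2 (MvPolynomial.funext fun x => by rw [hc x, map_zero])
  rw [map_mul, map_prod] at hx
  simp only [MvPolynomial.eval_X] at hx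
  have hx' : ∀ t, x t ≠ 0 := fun t => Finset.prod_ne_zero_iff.1 (right_ne_zero_of_mul hx) t
    (Finset.mem_univ t)
  refine ⟨fun i a => x (i, Sum.inl a), fun i a => x (i, Sum.inr a), h _ _
    (fun i h0 => hx' (i, Sum.inl 0) (congrFun h0 0)) (fun i h0 => hx' (i, Sum.inr 0) (congrFun h0 0)) ?_⟩
  convert! left_ne_zero_of_mul hx using 2
  congr 1
  ext ⟨i, a | a⟩ <;> rfl

/-! ### The ideal of the cone over the secant variety -/

theorem eval_smul_of_isHomogeneous {ι : Type} {F : MvPolynomial ι ℂ} {d : ℕ}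
    (hF : F.IsHomogeneous d) (c : ℂ) (x : ι → ℂ) :
    MvPolynomial.eval (c • x) F = c ^ d * MvPolynomial.eval x F := by
  rw [MvPolynomial.eval_eq, MvPolynomial.eval_eq, Finset.mul_sum]
  refine Finset.sum_congr rfl fun m hm => ?_
  have h1 := hF (MvPolynomial.mem_support_iff.1 hm)
  replace h1 : m.degree = d := by
    rw [Finsupp.degree_eq_weight_one]
    exact h1
  simp only [Pi.smul_apply, smul_eq_mul, mul_pow, Finset.prod_mul_distrib, Finset.prod_pow_eq_pow_sum]
  rw [← Finsupp.degree_apply, h1]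
  ring

theorem eval_aeval {ι τ : Type} (f : ι → MvPolynomial τ ℂ) (P : MvPolynomial ι ℂ) (x : τ → ℂ) :
    MvPolynomial.eval x (MvPolynomial.aeval f P) =
      MvPolynomial.eval (fun i => MvPolynomial.eval x (f i)) P := by
  induction P using MvPolynomial.induction_on with
  | C a => simp only [MvPolynomial.aeval_C, MvPolynomial.algebraMap_eq, MvPolynomial.eval_C]
  | add p q hp hq => simp only [map_add, hp, hq]
  | mul_X p i hp => simp only [map_mul, MvPolynomial.aeval_X, MvPolynomial.eval_X, hp]

/-- A polynomial vanishing on a line through the origin has all its homogeneous components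
vanishing there. -/
theorem eval_homogeneousComponent_eq_zero {ι : Type} (P : MvPolynomial ι ℂ) (x : ι → ℂ)
    (h : ∀ c : ℂ, MvPolynomial.eval (c • x) P = 0) (d : ℕ) :
    MvPolynomial.eval x (MvPolynomial.homogeneousComponent d P) = 0 := by
  -- `Q` is the restriction `c ↦ P(c x)`; its coefficients are the values of the homogeneous
  -- components.
  set Q : Polynomial ℂ := ∑ e ∈ Finset.range (P.totalDegree + 1),
    Polynomial.monomial e (MvPolynomial.eval x (MvPolynomial.homogeneousComponent e P)) with hQ
  have hQ0 : Q = 0 := by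
    refine Polynomial.funext fun c => ?_
    rw [Polynomial.eval_zero, ← h c]
    conv_rhs => rw [← MvPolynomial.sum_homogeneousComponent P]
    rw [hQ, Polynomial.eval_finsetSum, map_sum]
    refine Finset.sum_congr rfl fun e _ => ?_
    rw [eval_smul_of_isHomogeneous (MvPolynomial.homogeneousComponent_isHomogeneous e P),
      Polynomial.eval_monomial, mul_comm]
  by_cases hd : d < P.totalDegree + 1
  · have := congrArg (fun Q => Polynomial.coeff Q d) hQ0
    simpa [hQ, Polynomial.finsetSum_coeff, Polynomial.coeff_monomial, hd] using this
  · rw [MvPolynomial.homogeneousComponent_eq_zero _ _ (by omega), map_zero]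

/-- The points of the cone over the union of the spans of `s` points of `X`. -/
theorem exists_rep_eq_sum {m n s : ℕ} {y : ℙ ℂ (Idx m n → ℂ)} {p : Fin s → ℙ ℂ (Idx m n → ℂ)}
    (hp : ∀ i, p i ∈ X m n) (hy : y.submodule ≤ ⨆ i, (p i).submodule) :
    ∃ (u : Fin s → Fin (m + 1) → ℂ) (v : Fin s → Fin (n + 1) → ℂ),
      y.rep = ∑ i, tens (u i) (symMul (v i) (v i)) := by
  choose u v hu hv huv using hp
  have h1 : y.rep ∈ ⨆ i, (p i).submodule := by
    apply hy
    rw [y.submodule_eq]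
    exact Submodule.mem_span_singleton_self _
  rw [Submodule.mem_iSup_iff_exists_finsupp] at h1
  obtain ⟨f, hf, hsum⟩ := h1
  have h2 : ∀ i, ∃ c : ℂ, c • tens (u i) (symMul (v i) (v i)) = f i := by
    intro i
    have := hf i
    rw [huv i, Projectivization.submodule_mk, Submodule.mem_span_singleton] at this
    exact this
  choose c hc using h2
  -- The scalars of the linear combination are absorbed into the factors in `V`.
  refine ⟨fun i => c i • u i, v, ?_⟩
  rw [← hsum, Finsupp.sum_fintype _ _ (fun _ => rfl)]
  exact Finset.sum_congr rfl fun i _ => by rw [tens_smul_left, hc]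

theorem X_nonempty (m n : ℕ) : (X m n).Nonempty :=
  ⟨_, 1, 1, one_ne_zero, one_ne_zero, rfl⟩

theorem sum_mem_affineCone {m n s : ℕ} (u : Fin s → Fin (m + 1) → ℂ) (v : Fin s → Fin (n + 1) → ℂ) :
    ∑ i, tens (u i) (symMul (v i) (v i)) ∈ affineCone (secantVariety s (X m n)) := by
  classical
  by_cases hx : ∑ i, tens (u i) (symMul (v i) (v i)) = 0
  · exact Or.inl hx
  · refine Or.inr ⟨hx, fun F d _ hF => hF _ ?_⟩
    obtain ⟨q, hq⟩ := X_nonempty m n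
    -- A zero summand defines no point of `X`; an arbitrary point `q` stands in for it, since the
    -- summand lies in every line.
    refine ⟨fun i => if h : u i ≠ 0 ∧ v i ≠ 0 then
      Projectivization.mk ℂ (tens (u i) (symMul (v i) (v i))) (tens_ne_zero h.1 h.2) else q, ?_, ?_⟩
    · intro i
      dsimp only
      split_ifs with h
      · exact ⟨u i, v i, h.1, h.2, rfl⟩
      · exact hq
    · rw [Projectivization.submodule_mk, Submodule.span_singleton_le_iff_mem]
      refine Submodule.sum_mem _ fun i _ => Submodule.mem_iSup_of_mem i ?_
      dsimp only
      split_ifs with h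
      · rw [Projectivization.submodule_mk]
        exact Submodule.mem_span_singleton_self _
      · have : tens (u i) (symMul (v i) (v i)) = 0 := by
          rw [not_and_or, not_not, not_not] at h
          rcases h with h | h
          · rw [h]; exact ((tensHom m n).map_zero₂ _)
          · rw [h]
            have : symMul (0 : Fin (n + 1) → ℂ) 0 = 0 := (symMulHom n 0).map_zero
            rw [this]
            exact (tensHom m n (u i)).map_zero
        rw [this]
        exact Submodule.zero_mem _

theorem paramPoint_coords {m n s : ℕ} (x : Param m n s → ℂ) :
    paramPoint (fun i a => x (i, Sum.inl a)) (fun i a => x (i, Sum.inr a)) = x := by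
  ext ⟨i, a | a⟩ <;> rfl

theorem vanishingIdeal_le_ker (m n s : ℕ) :
    MvPolynomial.vanishingIdeal ℂ (affineCone (secantVariety s (X m n))) ≤
      RingHom.ker (MvPolynomial.aeval (secantParam m n s) (R := ℂ)) := by
  intro P hP
  rw [RingHom.mem_ker]
  refine MvPolynomial.funext fun x => ?_
  have h := hP _ (sum_mem_affineCone (fun i a => x (i, Sum.inl a)) (fun i a => x (i, Sum.inr a)))
  rw [← eval_secantParam, paramPoint_coords, MvPolynomial.aeval_eq_eval] at h
  rw [map_zero, eval_aeval]
  exact h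

/-- A homogeneous polynomial vanishing at all `∑ uᵢ ⊗ vᵢ²` vanishes on the cone over the secant
variety. -/
theorem eval_eq_zero_of_mem_affineCone {m n s d : ℕ} {F : MvPolynomial (Idx m n) ℂ}
    (hF : F.IsHomogeneous d)
    (h : ∀ (u : Fin s → Fin (m + 1) → ℂ) (v : Fin s → Fin (n + 1) → ℂ),
      MvPolynomial.eval (∑ i, tens (u i) (symMul (v i) (v i))) F = 0)
    {x : Idx m n → ℂ} (hx : x ∈ affineCone (secantVariety s (X m n))) :
    MvPolynomial.eval x F = 0 := by
  rcases hx with rfl | ⟨hx, hmem⟩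
  · have := h 0 0
    rwa [Finset.sum_eq_zero fun i _ => by exact (tensHom m n).map_zero₂ _] at this
  · have h1 := hmem F d hF (by
      rintro y ⟨p, hp, hy⟩
      obtain ⟨u, v, huv⟩ := exists_rep_eq_sum hp hy
      rw [huv]
      exact h u v)
    obtain ⟨a, ha⟩ := Projectivization.exists_smul_eq_mk_rep ℂ x hx
    rw [← ha] at h1
    change MvPolynomial.eval ((a : ℂ) • x) F = 0 at h1
    rw [eval_smul_of_isHomogeneous hF] at h1
    exact (mul_eq_zero.1 h1).resolve_left (pow_ne_zero _ a.ne_zero)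

/-- The parametrisation restricted to the points with first coordinate of `vᵢ` equal to `1`. -/
def affineSecantParam (m n s : ℕ) (x : Idx m n) :
    MvPolynomial (Fin s × (Fin (m + 1) ⊕ Fin n)) ℂ :=
  MvPolynomial.aeval (fun t : Param m n s => Sum.elim (fun a => MvPolynomial.X (t.1, Sum.inl a))
    (Fin.cons 1 fun l => MvPolynomial.X (t.1, Sum.inr l)) t.2) (secantParam m n s x)

theorem eval_affineSecantParam {m n s : ℕ} (u : Fin s → Fin (m + 1) → ℂ) (w : Fin s → Fin n → ℂ) :
    (fun x => MvPolynomial.eval (fun t : Fin s × (Fin (m + 1) ⊕ Fin n) =>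
      Sum.elim (u t.1) (w t.1) t.2) (affineSecantParam m n s x)) =
      ∑ i, tens (u i) (symMul (Fin.cons 1 (w i)) (Fin.cons 1 (w i))) := by
  rw [← eval_secantParam]
  ext x
  rw [affineSecantParam, eval_aeval]
  congr 2
  ext ⟨i, a | l⟩
  · simp [paramPoint]
  · refine Fin.cases ?_ (fun l => ?_) l <;> simp [paramPoint]

/-- Normalising `vᵢ` saves one parameter per point, leaving exactly `s(m+n+1)`. Nothing is lost: the
normalised sums are stable under scaling, so homogeneous components may be treated separately, and
they are dense among all sums. -/
theorem ker_le_vanishingIdeal (m n s : ℕ) :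
    RingHom.ker (MvPolynomial.aeval (affineSecantParam m n s) (R := ℂ)) ≤
      MvPolynomial.vanishingIdeal ℂ (affineCone (secantVariety s (X m n))) := by
  intro P hP x hx
  have h1 : ∀ (u : Fin s → Fin (m + 1) → ℂ) (w : Fin s → Fin n → ℂ),
      MvPolynomial.eval (∑ i, tens (u i) (symMul (Fin.cons 1 (w i)) (Fin.cons 1 (w i)))) P = 0 := by
    intro u w
    rw [← eval_affineSecantParam, ← eval_aeval, RingHom.mem_ker.1 hP, map_zero]
  have h2 : ∀ (d : ℕ) (u : Fin s → Fin (m + 1) → ℂ) (w : Fin s → Fin n → ℂ),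
      MvPolynomial.eval (∑ i, tens (u i) (symMul (Fin.cons 1 (w i)) (Fin.cons 1 (w i))))
        (MvPolynomial.homogeneousComponent d P) = 0 := by
    intro d u w
    refine eval_homogeneousComponent_eq_zero P _ (fun c => ?_) d
    rw [Finset.smul_sum, ← h1 (fun i => c • u i) w]
    simp only [tens_smul_left]
  have h3 : ∀ (d : ℕ) (u : Fin s → Fin (m + 1) → ℂ) (v : Fin s → Fin (n + 1) → ℂ),
      (∀ i, v i 0 ≠ 0) → MvPolynomial.eval (∑ i, tens (u i) (symMul (v i) (v i)))
        (MvPolynomial.homogeneousComponent d P) = 0 := by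
    intro d u v hv
    -- `u ⊗ v² = (v₀² u) ⊗ (v / v₀)²`.
    rw [← h2 d (fun i => (v i 0) ^ 2 • u i) (fun i l => (v i 0)⁻¹ * v i l.succ)]
    congr 2
    refine Finset.sum_congr rfl fun i _ => ?_
    have : v i = v i 0 • (Fin.cons 1 (fun l => (v i 0)⁻¹ * v i l.succ) : Fin (n + 1) → ℂ) := by
      ext l
      refine Fin.cases ?_ (fun l => ?_) l
      · simp
      · simp [hv i]
    conv_lhs => rw [this]
    rw [symMul_smul_left, symMul_smul_right, tens_smul_right, tens_smul_right, tens_smul_left,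
      smul_smul, sq]
  have h4 : ∀ d : ℕ, MvPolynomial.aeval (secantParam m n s) (R := ℂ)
      (MvPolynomial.homogeneousComponent d P) = 0 := by
    intro d
    -- Multiplying by the first coordinates covers the locus where some `vᵢ` cannot be normalised;
    -- the factor is then cancelled in a domain.
    have h5 : MvPolynomial.aeval (secantParam m n s) (R := ℂ)
      (MvPolynomial.homogeneousComponent d P) * ∏ i, MvPolynomial.X (i, Sum.inr 0) = 0 := by
      refine MvPolynomial.funext fun x => ?_
      rw [map_mul, map_prod, map_zero]
      by_cases hx : ∀ i, x (i, Sum.inr 0) ≠ 0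
      · have h6 := h3 d (fun i a => x (i, Sum.inl a)) (fun i a => x (i, Sum.inr a)) hx
        rw [← eval_secantParam, paramPoint_coords, ← eval_aeval] at h6
        rw [h6, zero_mul]
      · push Not at hx
        obtain ⟨i, hi⟩ := hx
        rw [Finset.prod_eq_zero (Finset.mem_univ i) (by rw [MvPolynomial.eval_X, hi]), mul_zero]
    exact (mul_eq_zero.1 h5).resolve_right
      (Finset.prod_ne_zero_iff.2 fun t _ => MvPolynomial.X_ne_zero _)
  rw [MvPolynomial.aeval_eq_eval, ← MvPolynomial.sum_homogeneousComponent P, map_sum]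
  refine Finset.sum_eq_zero fun d _ => ?_
  refine eval_eq_zero_of_mem_affineCone (MvPolynomial.homogeneousComponent_isHomogeneous d P)
    (fun u v => ?_) hx
  rw [← eval_secantParam, ← eval_aeval, h4, map_zero]

/-! ### Dimension of the secant variety -/

theorem ringKrullDim_secantVariety_le (m n s : ℕ) :
    ringKrullDim (HomogCoordRing (secantVariety s (X m n))) ≤
      (min (s * (m + n + 1)) ((m + 1) * (n + 2).choose 2) : ℕ) := by
  rcases min_choice (s * (m + n + 1)) ((m + 1) * (n + 2).choose 2) with h | h <;> rw [h]
  · refine (ringKrullDim_le_card_of_ker_le _ _ (ker_le_vanishingIdeal m n s)).trans ?_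
    simp only [Fintype.card_prod, Fintype.card_sum, Fintype.card_fin]
    rw [show m + 1 + n = m + n + 1 by ring]
  · refine (ringKrullDim_quotient_le _).trans ?_
    rw [MvPolynomial.ringKrullDim_of_isNoetherianRing, ringKrullDim_eq_zero_of_field, zero_add,
      Nat.card_eq_fintype_card, card_idx]

theorem hasDim_expectedDim_iff (m n s : ℕ) :
    HasDim (secantVariety s (X m n)) (expectedDim m n s) ↔
      ringKrullDim (HomogCoordRing (secantVariety s (X m n))) =
        (min (s * (m + n + 1)) ((m + 1) * (n + 2).choose 2) : ℕ) := by
  have h : expectedDim m n s = ((min (s * (m + n + 1)) ((m + 1) * (n + 2).choose 2) : ℕ) : ℤ) - 1 := by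
    rw [expectedDim]
    push_cast
    rw [min_sub_sub_right, min_comm]
  rw [h]
  constructor
  · rintro ⟨c, hc, hd⟩
    rw [hc]
    congr 1
    have : (c : ℤ) = ((min (s * (m + n + 1)) ((m + 1) * (n + 2).choose 2) : ℕ) : ℤ) := by linarith
    exact_mod_cast this
  · exact fun hc => ⟨_, hc, rfl⟩

/-- If `T(m,n;1,2;s)` holds then the secant variety is not defective (Terracini's lemma). -/
theorem not_isDefective_of_T {m n s : ℕ} (h : T m n s) : ¬ IsDefective m n s := by
  rw [IsDefective, not_not, hasDim_expectedDim_iff]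
  obtain ⟨u, v, huv⟩ := exists_of_T h
  refine le_antisymm (ringKrullDim_secantVariety_le m n s) ?_
  rw [← huv, ← span_jacobian]
  exact finrank_jacobian_le_ringKrullDim (secantParam m n s) _ (vanishingIdeal_le_ker m n s) _

/-! ### An equation of the secant variety of `X 2 n` -/

/-- The matrix of the cross product with `w`. -/
def crossMatrix {R : Type} [CommRing R] (w : Fin 3 → R) : Matrix (Fin 3) (Fin 3) R :=
  !![0, -w 2, w 1; w 2, 0, -w 0; -w 1, w 0, 0]

/-- The matrix of the map `V ⊗ W* → ⋀²V ⊗ W` given by a tensor in `V ⊗ S₂(W)`, `dim V = 3`. -/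
def koszulMatrix {R : Type} [CommRing R] {n : ℕ} (t : Idx 2 n → R) :
    Matrix (Fin 3 × Fin (n + 1)) (Fin 3 × Fin (n + 1)) R :=
  Matrix.of fun x y => crossMatrix (fun c => t (c, s(x.2, y.2))) x.1 y.1

theorem koszulMatrix_map {R S : Type} [CommRing R] [CommRing S] {n : ℕ} (f : R →+* S)
    (t : Idx 2 n → R) : (koszulMatrix t).map f = koszulMatrix (fun x => f (t x)) := by
  ext ⟨a, j⟩ ⟨b, k⟩
  fin_cases a <;> fin_cases b <;> simp [koszulMatrix, crossMatrix]

theorem koszulMatrix_add {n : ℕ} (t t' : Idx 2 n → ℂ) :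
    koszulMatrix (t + t') = koszulMatrix t + koszulMatrix t' := by
  ext ⟨a, j⟩ ⟨b, k⟩
  fin_cases a <;> fin_cases b <;> simp [koszulMatrix, crossMatrix] <;> ring

theorem koszulMatrix_zero {n : ℕ} : koszulMatrix (0 : Idx 2 n → ℂ) = 0 := by
  ext ⟨a, j⟩ ⟨b, k⟩
  fin_cases a <;> fin_cases b <;> simp [koszulMatrix, crossMatrix]

/-- A skew-symmetric matrix of odd size is singular. -/
theorem rank_crossMatrix_le (w : Fin 3 → ℂ) : (crossMatrix w).rank ≤ 2 := by
  by_contra! h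
  have h1 : (crossMatrix w).rank = 3 := le_antisymm (Matrix.rank_le_width _) h
  have h2 : LinearIndependent ℂ (crossMatrix w).row := by
    rw [linearIndependent_iff_card_eq_finrank_span, Fintype.card_fin]
    exact h1.symm.trans (Matrix.rank_eq_finrank_span_row _)
  rw [Matrix.linearIndependent_rows_iff_isUnit, Matrix.isUnit_iff_isUnit_det] at h2
  refine h2.ne_zero ?_
  rw [crossMatrix, Matrix.det_fin_three]
  simp
  ring

/-- On `u ⊗ v²` the Koszul matrix factors through the cross product with `u`, as `(1 ⊗ v) [u]ₓ (1 ⊗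
v)ᵀ`. -/
theorem rank_koszulMatrix_tens_le {n : ℕ} (u : Fin 3 → ℂ) (v : Fin (n + 1) → ℂ) :
    (koszulMatrix (tens (m := 2) u (symMul v v))).rank ≤ 2 := by
  set A : Matrix (Fin 3 × Fin (n + 1)) (Fin 3) ℂ := Matrix.of fun x a => if x.1 = a then v x.2 else 0
  have h : koszulMatrix (tens (m := 2) u (symMul v v)) = A * crossMatrix u * A.transpose := by
    ext ⟨a, j⟩ ⟨b, k⟩
    fin_cases a <;> fin_cases b <;>
      simp [koszulMatrix, crossMatrix, tens, symMul_self, A, Matrix.mul_apply] <;>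
      ring
  rw [h]
  exact (Matrix.rank_mul_le_left _ _).trans ((Matrix.rank_mul_le_right _ _).trans
    (rank_crossMatrix_le u))

theorem matrix_rank_add_le {ι : Type} [Fintype ι] (A B : Matrix ι ι ℂ) :
    (A + B).rank ≤ A.rank + B.rank := by
  rw [Matrix.rank, Matrix.mulVecLin_add]
  refine le_trans (Submodule.finrank_mono ?_) (Submodule.finrank_add_le_finrank_add_finrank _ _)
  rintro _ ⟨x, rfl⟩
  exact Submodule.add_mem_sup ⟨x, rfl⟩ ⟨x, rfl⟩

theorem rank_koszulMatrix_sum_le {n s : ℕ} (u : Fin s → Fin 3 → ℂ) (v : Fin s → Fin (n + 1) → ℂ) :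
    (koszulMatrix (∑ i, tens (m := 2) (u i) (symMul (v i) (v i)))).rank ≤ 2 * s := by
  have key : ∀ S : Finset (Fin s),
      (koszulMatrix (∑ i ∈ S, tens (m := 2) (u i) (symMul (v i) (v i)))).rank ≤ 2 * S.card := by
    intro S
    induction S using Finset.induction_on with
    | empty => simp [koszulMatrix_zero]
    | insert i S hi ih =>
      rw [Finset.sum_insert hi, Finset.card_insert_of_notMem hi, koszulMatrix_add]
      have h1 := matrix_rank_add_le (koszulMatrix (tens (m := 2) (u i) (symMul (v i) (v i))))
        (koszulMatrix (∑ i ∈ S, tens (m := 2) (u i) (symMul (v i) (v i))))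
      have h2 := rank_koszulMatrix_tens_le (u i) (v i)
      omega
  simpa using key Finset.univ

theorem det_koszulMatrix_sum_eq_zero {n s : ℕ} (hs : 2 * s < 3 * (n + 1)) (u : Fin s → Fin 3 → ℂ)
    (v : Fin s → Fin (n + 1) → ℂ) :
    (koszulMatrix (∑ i, tens (m := 2) (u i) (symMul (v i) (v i)))).det = 0 := by
  by_contra h
  have h1 := Matrix.rank_of_det_ne_zero h
  have h2 := rank_koszulMatrix_sum_le u v
  rw [Fintype.card_prod, Fintype.card_fin, Fintype.card_fin] at h1
  omega

/-- The determinant of the generic Koszul matrix. -/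
def koszulDet (n : ℕ) : MvPolynomial (Idx 2 n) ℂ :=
  (koszulMatrix fun x => MvPolynomial.X x).det

theorem eval_koszulDet {n : ℕ} (t : Idx 2 n → ℂ) :
    MvPolynomial.eval t (koszulDet n) = (koszulMatrix t).det := by
  rw [koszulDet, RingHom.map_det, RingHom.mapMatrix_apply, koszulMatrix_map]
  simp only [MvPolynomial.eval_X]

theorem koszulDet_isHomogeneous (n : ℕ) :
    (koszulDet n).IsHomogeneous (Fintype.card (Fin 3 × Fin (n + 1))) := by
  rw [koszulDet, Matrix.det_apply]
  refine MvPolynomial.IsHomogeneous.sum _ _ _ fun σ _ => ?_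
  have h : (∏ i, koszulMatrix (fun x : Idx 2 n => (MvPolynomial.X x : MvPolynomial (Idx 2 n) ℂ))
      (σ i) i).IsHomogeneous (∑ _i : Fin 3 × Fin (n + 1), 1) := by
    refine MvPolynomial.IsHomogeneous.prod _ _ _ fun i _ => ?_
    obtain ⟨a, j⟩ := σ i
    obtain ⟨b, k⟩ := i
    have hX : ∀ c : Fin 3, (MvPolynomial.X (c, s(j, k)) : MvPolynomial (Idx 2 n) ℂ).IsHomogeneous 1 :=
      fun c => MvPolynomial.isHomogeneous_X _ _
    have h0 := MvPolynomial.isHomogeneous_zero (Idx 2 n) ℂ 1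
    fin_cases a <;> fin_cases b <;> simp [koszulMatrix, crossMatrix, hX, h0, (hX _).neg]
  rw [Finset.sum_const, smul_eq_mul, mul_one, Finset.card_univ] at h
  rcases Int.units_eq_one_or (Equiv.Perm.sign σ) with hs | hs <;> rw [hs]
  · rwa [one_smul]
  · rw [Units.neg_smul, one_smul]
    exact h.neg

/-- For odd `n`, a tensor with invertible Koszul matrix. -/
def koszulWitness (k : ℕ) : Idx 2 (2 * k + 1) → ℂ := fun x =>
  Sym2.lift ⟨fun i j : Fin (2 * k + 1 + 1) =>
    ![if i = j then 1 else 0, if i = j then (if (i : ℕ) ≤ k then 1 else -1) else 0,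
      if j = i.rev then 1 else 0] x.1, fun i j => by
    have h1 : j = i.rev ↔ i = j.rev :=
      ⟨fun h => by rw [h, Fin.rev_rev], fun h => by rw [h, Fin.rev_rev]⟩
    by_cases h : i = j
    · subst h; rfl
    · simp only [h, Ne.symm h, h1, if_false]⟩ x.2

/-- The three slices are `1`, a sign matrix `D` and the reversal `R`. A kernel vector satisfies `x₁
= D x₀`, `x₂ = R x₀` and `(DR - RD) x₀ = 0`. Since `n + 1` is even, `R` swaps the two halves on
which `D` is `±1`; so `DR = -RD` and `x₀ = 0`. -/
theorem det_koszulWitness_ne_zero (k : ℕ) : (koszulMatrix (koszulWitness k)).det ≠ 0 := by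
  intro hdet
  obtain ⟨x, hx, h0⟩ := Matrix.exists_mulVec_eq_zero_iff.2 hdet
  have hrow : ∀ a j, ∑ b, ∑ l, koszulMatrix (koszulWitness k) (a, j) (b, l) * x (b, l) = 0 := by
    intro a j
    rw [← Fintype.sum_prod_type']
    exact congrFun h0 (a, j)
  have e0 : ∀ j : Fin (2 * k + 1 + 1), -x (1, j.rev) + (if (j : ℕ) ≤ k then 1 else -1) * x (2, j) = 0 := by
    intro j
    have := hrow 0 j
    simpa [Fin.sum_univ_three, koszulMatrix, crossMatrix, koszulWitness] using this
  have e1 : ∀ j : Fin (2 * k + 1 + 1), x (0, j.rev) - x (2, j) = 0 := by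
    intro j
    have := hrow 1 j
    simpa [Fin.sum_univ_three, koszulMatrix, crossMatrix, koszulWitness, sub_eq_add_neg] using this
  have e2 : ∀ j : Fin (2 * k + 1 + 1), -((if (j : ℕ) ≤ k then 1 else -1) * x (0, j)) + x (1, j) = 0 := by
    intro j
    have := hrow 2 j
    simpa [Fin.sum_univ_three, koszulMatrix, crossMatrix, koszulWitness] using this
  have z0 : ∀ j, x (0, j) = 0 := by
    intro j
    have a0 := e0 j.rev
    have a1 := e1 j.rev
    have a2 := e2 j
    rw [Fin.rev_rev] at a0 a1
    have hj : ((j.rev : Fin (2 * k + 1 + 1)) : ℕ) = 2 * k + 1 - j := by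
      rw [Fin.val_rev]; omega
    have := j.isLt
    by_cases h : (j : ℕ) ≤ k
    · rw [if_neg (by omega)] at a0
      rw [if_pos h] at a2
      linear_combination (-a0 + a1 - a2) / 2
    · rw [if_pos (by omega)] at a0
      rw [if_neg h] at a2
      linear_combination (a0 + a1 + a2) / 2
  refine hx (funext fun ⟨a, j⟩ => ?_)
  fin_cases a
  · exact z0 j
  · have := e2 j
    rw [z0] at this
    simpa using this
  · have := e1 j
    rw [z0] at this
    simpa using this

theorem choose_two_odd (k : ℕ) : (2 * k + 1 + 2).choose 2 = (k + 1) * (2 * k + 3) := by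
  rw [Nat.choose_two_right, show (2 * k + 1 + 2) * (2 * k + 1 + 2 - 1) = (k + 1) * (2 * k + 3) * 2 by
    rw [show 2 * k + 1 + 2 - 1 = 2 * k + 2 by omega]; ring, Nat.mul_div_cancel _ two_pos]

theorem isDefective_of_exceptional {k : ℕ} (hk : 1 ≤ k) : IsDefective 2 (2 * k + 1) (3 * k + 2) := by
  rw [IsDefective, hasDim_expectedDim_iff]
  intro h
  set I := MvPolynomial.vanishingIdeal ℂ (affineCone (secantVariety (3 * k + 2) (X 2 (2 * k + 1))))
  have hne : koszulDet (2 * k + 1) ≠ 0 := by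
    intro h0
    apply det_koszulWitness_ne_zero k
    rw [← eval_koszulDet, h0, map_zero]
  have hmem : koszulDet (2 * k + 1) ∈ I := by
    intro x hx
    rw [MvPolynomial.aeval_eq_eval]
    refine eval_eq_zero_of_mem_affineCone (koszulDet_isHomogeneous _) (fun u v => ?_) hx
    -- The inequality is `2(3k+2) = 6k+4 < 6k+6`.
    rw [eval_koszulDet, det_koszulMatrix_sum_eq_zero (by omega)]
  have h1 := ringKrullDim_succ_le_of_surjective (Ideal.Quotient.mk I) Ideal.Quotient.mk_surjective
    (mem_nonZeroDivisors_of_ne_zero hne) (Ideal.Quotient.eq_zero_iff_mem.2 hmem)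
  rw [h, MvPolynomial.ringKrullDim_of_isNoetherianRing, ringKrullDim_eq_zero_of_field, zero_add,
    Nat.card_eq_fintype_card, card_idx, min_eq_right] at h1
  · have h2 : (2 + 1) * (2 * k + 1 + 2).choose 2 + 1 ≤ (2 + 1) * (2 * k + 1 + 2).choose 2 := by
      exact_mod_cast h1
    omega
  -- The expected dimension is that of the whole space: `(3k+2)(2k+4) - 3(k+1)(2k+3) = k - 1`, which
  -- is nonnegative because `k ≥ 1`.
  · rw [choose_two_odd]
    nlinarith

/-! ### Varying the number of points -/

/-- If the tangent spaces at `s` points are independent, then `T(m,n;1,2;s')` holds for `s' ≤ s`. -/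
theorem T_of_le {m n s s' : ℕ} (u : Fin s → Fin (m + 1) → ℂ) (v : Fin s → Fin (n + 1) → ℂ)
    (h : s * (m + n + 1) ≤ Module.finrank ℂ ↥(⨆ i, tangentCone (u i) (v i))) (hs : s' ≤ s) :
    T m n s' := by
  obtain ⟨r, rfl⟩ := Nat.exists_eq_add_of_le hs
  refine T_of_exists (fun i => u (Fin.castAdd r i)) (fun i => v (Fin.castAdd r i))
    ((min_le_left _ _).trans ?_)
  have h1 : (⨆ i, tangentCone (u i) (v i)) ≤
      (⨆ i, tangentCone (u (Fin.castAdd r i)) (v (Fin.castAdd r i))) ⊔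
        ⨆ i, tangentCone (u (Fin.natAdd s' i)) (v (Fin.natAdd s' i)) := by
    refine iSup_le fun i => ?_
    refine Fin.addCases (fun j => ?_) (fun j => ?_) i
    · exact le_sup_of_le_left
        (le_iSup (fun j => tangentCone (u (Fin.castAdd r j)) (v (Fin.castAdd r j))) j)
    · exact le_sup_of_le_right
        (le_iSup (fun j => tangentCone (u (Fin.natAdd s' j)) (v (Fin.natAdd s' j))) j)
  have h2 := (Submodule.finrank_mono h1).trans (Submodule.finrank_add_le_finrank_add_finrank _ _)
  have h3 := finrank_iSup_le_sum (fun i => tangentCone (u (Fin.natAdd s' i)) (v (Fin.natAdd s' i)))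
    (m + n + 1) (fun i => finrank_tangentCone_le _ _)
  rw [Fintype.card_fin] at h3
  rw [add_mul] at h
  omega

/-- If the tangent spaces at `s` points span everything, then `T(m,n;1,2;s')` holds for
`s ≤ s'`. -/
theorem T_of_ge {m n s s' : ℕ} (u : Fin s → Fin (m + 1) → ℂ) (v : Fin s → Fin (n + 1) → ℂ)
    (h : (m + 1) * (n + 2).choose 2 ≤ Module.finrank ℂ ↥(⨆ i, tangentCone (u i) (v i)))
    (hs : s ≤ s') : T m n s' := by
  obtain ⟨r, rfl⟩ := Nat.exists_eq_add_of_le hs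
  -- Zero vectors are allowed as extra points, because the test configuration need not be
  -- nondegenerate.
  refine T_of_exists (Fin.append u 0) (Fin.append v 0) ((min_le_right _ _).trans (h.trans ?_))
  refine Submodule.finrank_mono (iSup_le fun i => ?_)
  have := le_iSup (fun j => tangentCone (Fin.append u 0 j) (Fin.append v (0 : Fin r → _) j))
    (Fin.castAdd r i)
  simpa only [Fin.append_left] using this

/-! ### The case `m = 1` -/

theorem single_idx {m n : ℕ} (a : Fin (m + 1)) (j k : Fin (n + 1)) :
    (Pi.single (a, s(j, k)) 1 : Idx m n → ℂ) =
      (if j = k then 1 else 2 : ℂ) •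
        tens (Pi.single a 1) (symMul (Pi.single j 1) (Pi.single k 1)) := by
  ext ⟨b, q⟩
  induction q using Sym2.inductionOn with
  | hf j' k' =>
    simp only [tens, symMul, Sym2.lift_mk, Pi.single_apply, Pi.smul_apply, smul_eq_mul,
      Prod.mk.injEq, Sym2.eq_iff]
    by_cases hb : b = a
    · by_cases h1 : j' = j <;> by_cases h2 : k' = k <;> by_cases h3 : j' = k <;>
        by_cases h4 : k' = j <;> grind
    · simp [hb]

theorem eq_top_of_tens_mem {m n : ℕ} (S : Submodule ℂ (Idx m n → ℂ))
    (h : ∀ a j k, tens (Pi.single a 1) (symMul (Pi.single j 1) (Pi.single k 1)) ∈ S) : S = ⊤ := by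
  rw [eq_top_iff]
  intro x _
  refine pi_mem_span_of_linear S LinearMap.id (fun i => ?_) x
  obtain ⟨a, q⟩ := i
  induction q using Sym2.inductionOn with
  | hf j k =>
    rw [LinearMap.id_apply, single_idx]
    exact S.smul_mem _ (h a j k)

theorem tens_mem_tangentCone_left {m n : ℕ} (u a : Fin (m + 1) → ℂ) (v : Fin (n + 1) → ℂ) :
    tens a (symMul v v) ∈ tangentCone u v :=
  Submodule.mem_sup_left (Submodule.subset_span ⟨a, rfl⟩)

theorem tens_mem_tangentCone_right {m n : ℕ} (u : Fin (m + 1) → ℂ) (v w : Fin (n + 1) → ℂ) :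
    tens u (symMul v w) ∈ tangentCone u v :=
  Submodule.mem_sup_right (Submodule.subset_span ⟨w, rfl⟩)

/-- The squares `eⱼ²` come with all of `V`. A mixed product `eⱼeₖ` occurs with both `uⱼ` and `uₖ`,
and the vectors `(1, j)`, `(1, k)` form a basis of `ℂ²`. -/
theorem iSup_tangentCone_basis_eq_top (n : ℕ) :
    (⨆ i : Fin (n + 1), tangentCone (m := 1) ![1, (i : ℂ)] (Pi.single i 1 : Fin (n + 1) → ℂ)) = ⊤ := by
  refine eq_top_of_tens_mem _ fun a j k => ?_
  by_cases hjk : j = k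
  · subst hjk
    exact Submodule.mem_iSup_of_mem j (tens_mem_tangentCone_left _ _ _)
  · have hne : (j : ℂ) - (k : ℂ) ≠ 0 := by
      rw [sub_ne_zero]
      exact fun h => hjk (Fin.ext (by exact_mod_cast h))
    have hj := Submodule.mem_iSup_of_mem (p := fun i : Fin (n + 1) =>
      tangentCone (m := 1) ![1, (i : ℂ)] (Pi.single i 1 : Fin (n + 1) → ℂ)) j
      (tens_mem_tangentCone_right _ _ (Pi.single k 1))
    have hk := Submodule.mem_iSup_of_mem (p := fun i : Fin (n + 1) =>
      tangentCone (m := 1) ![1, (i : ℂ)] (Pi.single i 1 : Fin (n + 1) → ℂ)) k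
      (tens_mem_tangentCone_right _ _ (Pi.single j 1))
    rw [symMul_comm] at hk
    -- The coefficients are given by Cramer's rule.
    have ha : (Pi.single a 1 : Fin 2 → ℂ) = (![-(k : ℂ), 1] a / ((j : ℂ) - k)) • ![1, (j : ℂ)] +
        (![(j : ℂ), -1] a / ((j : ℂ) - k)) • ![1, (k : ℂ)] := by
      ext b
      fin_cases a <;> fin_cases b <;> simp <;> field_simp <;> ring
    rw [ha, tens_add_left, tens_smul_left, tens_smul_left]
    exact Submodule.add_mem _ (Submodule.smul_mem _ _ hj) (Submodule.smul_mem _ _ hk)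

/-- Since `(n+1)(n+2) = 2 · binom(n+2, 2)`, the spanning configuration of `n + 1` points is also
independent, which settles smaller and larger `s` together. -/
theorem T_one (n s : ℕ) : T 1 n s := by
  have h : Module.finrank ℂ ↥(⨆ i : Fin (n + 1),
      tangentCone (m := 1) ![1, (i : ℂ)] (Pi.single i 1 : Fin (n + 1) → ℂ)) =
        (1 + 1) * (n + 2).choose 2 := by
    rw [iSup_tangentCone_basis_eq_top, finrank_top, Module.finrank_fintype_fun_eq_card, card_idx]
  rcases le_total s (n + 1) with hs | hs
  · refine T_of_le (fun i : Fin (n + 1) => ![1, (i : ℂ)]) (fun i => Pi.single i 1) (le_of_eq ?_) hs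
    rw [h, Nat.choose_two_right, one_add_one_eq_two, Nat.mul_div_cancel' (Nat.even_mul_pred_self _).two_dvd]
    rw [show n + 2 - 1 = n + 1 by omega]
    ring
  · exact T_of_ge _ _ h.ge hs

/-! ### Extending the space `W` by a plane -/

/-- The inclusion of `ℂ^{n+1}` in `ℂ^{n+3}` as the last coordinates. -/
def planeExt {n : ℕ} (x : Fin (n + 1) → ℂ) : Fin (n + 3) → ℂ :=
  Fin.cons (α := fun _ => ℂ) 0 (Fin.cons (α := fun _ => ℂ) 0 x)

/-- The retraction of indices used to extend tensors by zero. -/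
def idxRetract {n : ℕ} : Fin (n + 3) → Fin (n + 1) :=
  Fin.cons (α := fun _ => Fin (n + 1)) 0 (Fin.cons (α := fun _ => Fin (n + 1)) 0 id)

/-- Extension by zero of tensors from `V ⊗ S₂(ℂ^{n+1})` to `V ⊗ S₂(ℂ^{n+3})`. -/
def tensorExt (m n : ℕ) : (Idx m n → ℂ) →ₗ[ℂ] (Idx m (n + 2) → ℂ) where
  -- The first factor is the indicator of pairs avoiding the two new indices; it discards the
  -- arbitrary value 0 of `idxRetract` there.
  toFun t x := symMul (planeExt (1 : Fin (n + 1) → ℂ)) (planeExt 1) x.2 * t (x.1, x.2.map idxRetract)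
  map_add' t t' := by ext x; simp [mul_add]
  map_smul' c t := by ext x; simp [mul_left_comm]

theorem planeExt_apply {n : ℕ} (x : Fin (n + 1) → ℂ) (j : Fin (n + 3)) :
    planeExt x j = planeExt 1 j * x (idxRetract j) := by
  refine Fin.cases ?_ (fun j => Fin.cases ?_ (fun j => ?_) j) j <;> simp [planeExt, idxRetract]

theorem tensorExt_tens {m n : ℕ} (a : Fin (m + 1) → ℂ) (x y : Fin (n + 1) → ℂ) :
    tensorExt m n (tens a (symMul x y)) = tens a (symMul (planeExt x) (planeExt y)) := by
  ext ⟨b, q⟩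
  induction q using Sym2.inductionOn with
  | hf j k =>
    simp only [tensorExt, LinearMap.coe_mk, AddHom.coe_mk, tens, Sym2.map_mk, symMul,
      Sym2.lift_mk]
    rw [planeExt_apply x j, planeExt_apply x k, planeExt_apply y j, planeExt_apply y k]
    ring

theorem eq_planeExt {n : ℕ} (w : Fin (n + 3) → ℂ) :
    w = w 0 • Pi.single 0 1 + w 1 • Pi.single 1 1 + planeExt (fun j => w j.succ.succ) := by
  ext j
  refine Fin.cases ?_ (fun j => Fin.cases ?_ (fun j => ?_) j) j
  · simp [planeExt]
  · simp [planeExt]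
  · have h : (j.succ.succ : Fin (n + 3)) ≠ 1 := fun h => by
      have := congrArg Fin.val h
      simp at this
    simp [planeExt, h]

/-! ### Functionals on tensors as symmetric trilinear forms -/

/-- The trilinear form given by a functional on `V ⊗ S₂(W)`. -/
def form {m n : ℕ} (ℓ : Module.Dual ℂ (Idx m n → ℂ)) (a : Fin (m + 1) → ℂ) (v w : Fin (n + 1) → ℂ) :
    ℂ := ℓ (tens a (symMul v w))

section form

variable {m n : ℕ} (ℓ : Module.Dual ℂ (Idx m n → ℂ))

theorem form_comm (a : Fin (m + 1) → ℂ) (v w : Fin (n + 1) → ℂ) : form ℓ a v w = form ℓ a w v := by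
  rw [form, symMul_comm, form]

theorem form_add_left (a b : Fin (m + 1) → ℂ) (v w : Fin (n + 1) → ℂ) :
    form ℓ (a + b) v w = form ℓ a v w + form ℓ b v w := by
  simp only [form, tens_add_left, map_add]

theorem form_smul_left (c : ℂ) (a : Fin (m + 1) → ℂ) (v w : Fin (n + 1) → ℂ) :
    form ℓ (c • a) v w = c * form ℓ a v w := by
  simp only [form, tens_smul_left, map_smul, smul_eq_mul]

theorem form_add_mid (a : Fin (m + 1) → ℂ) (v v' w : Fin (n + 1) → ℂ) :
    form ℓ a (v + v') w = form ℓ a v w + form ℓ a v' w := by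
  simp only [form, symMul_add_left, tens_add_right, map_add]

theorem form_smul_mid (c : ℂ) (a : Fin (m + 1) → ℂ) (v w : Fin (n + 1) → ℂ) :
    form ℓ a (c • v) w = c * form ℓ a v w := by
  simp only [form, symMul_smul_left, tens_smul_right, map_smul, smul_eq_mul]

theorem form_add_right (a : Fin (m + 1) → ℂ) (v w w' : Fin (n + 1) → ℂ) :
    form ℓ a v (w + w') = form ℓ a v w + form ℓ a v w' := by
  simp only [form, symMul_add_right, tens_add_right, map_add]

theorem form_smul_right (c : ℂ) (a : Fin (m + 1) → ℂ) (v w : Fin (n + 1) → ℂ) :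
    form ℓ a v (c • w) = c * form ℓ a v w := by
  simp only [form, symMul_smul_right, tens_smul_right, map_smul, smul_eq_mul]

theorem eq_zero_of_form_eq_zero (h : ∀ a v w, form ℓ a v w = 0) : ℓ = 0 := by
  have : LinearMap.ker ℓ = ⊤ := eq_top_of_tens_mem _ fun a j k => h _ _ _
  exact LinearMap.ker_eq_top.1 this

theorem form_tangentCone_left {u : Fin (m + 1) → ℂ} {v : Fin (n + 1) → ℂ}
    (h : ℓ ∈ (tangentCone u v).dualAnnihilator) (a : Fin (m + 1) → ℂ) : form ℓ a v v = 0 :=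
  (Submodule.mem_dualAnnihilator _).1 h _ (tens_mem_tangentCone_left u a v)

theorem form_tangentCone_right {u : Fin (m + 1) → ℂ} {v : Fin (n + 1) → ℂ}
    (h : ℓ ∈ (tangentCone u v).dualAnnihilator) (w : Fin (n + 1) → ℂ) : form ℓ u v w = 0 :=
  (Submodule.mem_dualAnnihilator _).1 h _ (tens_mem_tangentCone_right u v w)

theorem mem_dualAnnihilator_tangentCone {u : Fin (m + 1) → ℂ} {v : Fin (n + 1) → ℂ}
    (h1 : ∀ a, form ℓ a v v = 0) (h2 : ∀ w, form ℓ u v w = 0) :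
    ℓ ∈ (tangentCone u v).dualAnnihilator := by
  rw [tangentCone, Submodule.dualAnnihilator_sup_eq, Submodule.mem_inf]
  constructor <;> rw [Submodule.mem_dualAnnihilator] <;> intro w hw
  · refine Submodule.span_induction ?_ (map_zero _) (fun x y _ _ hx hy => by rw [map_add, hx, hy, add_zero])
      (fun c x _ hx => by rw [map_smul, hx, smul_zero]) hw
    rintro _ ⟨a, rfl⟩
    exact h1 a
  · refine Submodule.span_induction ?_ (map_zero _) (fun x y _ _ hx hy => by rw [map_add, hx, hy, add_zero])
      (fun c x _ hx => by rw [map_smul, hx, smul_zero]) hw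
    rintro _ ⟨a, rfl⟩
    exact h2 a

theorem mem_dualAnnihilator_iSup_tangentCone {σ : Type} {u : σ → Fin (m + 1) → ℂ}
    {v : σ → Fin (n + 1) → ℂ} : ℓ ∈ (⨆ i, tangentCone (u i) (v i)).dualAnnihilator ↔
      ∀ i, ℓ ∈ (tangentCone (u i) (v i)).dualAnnihilator := by
  rw [Submodule.dualAnnihilator_iSup_eq, Submodule.mem_iInf]

end form

theorem form_decomp {n : ℕ} (ℓ : Module.Dual ℂ (Idx 2 n → ℂ)) (a : Fin 3 → ℂ)
    (v w : Fin (n + 1) → ℂ) : form ℓ a v w = a 0 * form ℓ (Pi.single 0 1) v w +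
      a 1 * form ℓ (Pi.single 1 1) v w + a 2 * form ℓ (Pi.single 2 1) v w := by
  rw [← form_smul_left, ← form_smul_left, ← form_smul_left, ← form_add_left, ← form_add_left]
  congr 1
  ext j
  fin_cases j <;> simp

/-! ### The kernel of the restriction to `ℂ^{n+1}` -/

/-- The embedding of a vector as one of three blocks. -/
def block {n : ℕ} (c : Fin 3) : (Fin (n + 1) → ℂ) →ₗ[ℂ] (Fin 3 × Fin (n + 1) → ℂ) where
  toFun x p := if p.1 = c then x p.2 else 0
  map_add' x y := by ext p; by_cases h : p.1 = c <;> simp [h]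
  map_smul' r x := by ext p; by_cases h : p.1 = c <;> simp [h]

/-- The conditions imposed on a form that vanishes on `ℂ^{n+1}` by points of `ℂ^{n+1}` and three
further points. -/
def extConditions {n : ℕ} {σ : Type} (u : σ → Fin 3 → ℂ) (v : σ → Fin (n + 1) → ℂ)
    (z : Fin (n + 1) → ℂ) : Fin 3 ⊕ σ ⊕ σ → Fin 3 × Fin (n + 1) → ℂ :=
  Sum.elim (fun c => block c z) (Sum.elim
    (fun i => u i 1 • block 0 (v i) + u i 2 • block 1 (v i))
    (fun i => u i 0 • block 2 (v i) - u i 2 • block 1 (v i)))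

/-- The data of a form vanishing on `ℂ^{n+1}` and on the tangent spaces at three further points. -/
def extData (n : ℕ) : Module.Dual ℂ (Idx 2 (n + 2) → ℂ) →ₗ[ℂ]
    Module.Dual ℂ (Fin 3 × Fin (n + 1) → ℂ) where
  toFun ℓ := Fintype.linearCombination ℂ fun p : Fin 3 × Fin (n + 1) =>
    -- With `e`, `f` the new basis vectors and `ε₀, ε₁, ε₂` the basis of `V`, these are the forms
    -- `(ε₁, e, ·)`, `(ε₂, e, ·)` and `(ε₀, f, ·)`. Of the other three, the new points kill `(ε₀, e,
    -- ·)` and `(ε₁, f, ·)`, and force `(ε₂, f, ·) = -(ε₂, e, ·)` when the form vanishes on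
    -- `ℂ^{n+1}`.
    form ℓ (Pi.single (![1, 2, 0] p.1) 1) (Pi.single (![0, 0, 1] p.1) 1) (planeExt (Pi.single p.2 1))
  map_add' ℓ ℓ' := by ext p; simp [form, Fintype.linearCombination_apply, mul_add, Finset.sum_add_distrib]
  map_smul' c ℓ := by ext p; simp [form, Fintype.linearCombination_apply, mul_left_comm, Finset.mul_sum]

theorem planeExt_add {n : ℕ} (x y : Fin (n + 1) → ℂ) : planeExt (x + y) = planeExt x + planeExt y := by
  ext j; refine Fin.cases ?_ (fun j => Fin.cases ?_ (fun j => ?_) j) j <;> simp [planeExt]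

theorem planeExt_smul {n : ℕ} (c : ℂ) (x : Fin (n + 1) → ℂ) : planeExt (c • x) = c • planeExt x := by
  ext j; refine Fin.cases ?_ (fun j => Fin.cases ?_ (fun j => ?_) j) j <;> simp [planeExt]

theorem extData_block {n : ℕ} (ℓ : Module.Dual ℂ (Idx 2 (n + 2) → ℂ)) (c : Fin 3)
    (x : Fin (n + 1) → ℂ) : extData n ℓ (block c x) =
      form ℓ (Pi.single (![1, 2, 0] c) 1) (Pi.single (![0, 0, 1] c) 1) (planeExt x) := by
  let L : (Fin (n + 1) → ℂ) →ₗ[ℂ] ℂ :=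
    { toFun := fun x => form ℓ (Pi.single (![1, 2, 0] c) 1) (Pi.single (![0, 0, 1] c) 1) (planeExt x)
      map_add' := fun x y => by rw [planeExt_add, form_add_right]
      map_smul' := fun r x => by rw [planeExt_smul, form_smul_right]; rfl }
  change (extData n ℓ ∘ₗ block c) x = L x
  congr 1
  refine LinearMap.pi_ext' fun j => LinearMap.ext_ring ?_
  simp only [extData, LinearMap.coe_mk, AddHom.coe_mk, LinearMap.comp_apply, LinearMap.coe_single, L]
  rw [Fintype.linearCombination_apply, Finset.sum_eq_single (c, j)]
  · simp [block]
  · rintro ⟨c', j'⟩ _ hne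
    by_cases h : c' = c
    · have : j' ≠ j := fun h' => hne (by rw [h, h'])
      simp [block, this]
    · simp [block, h]
  · simp

section kernel

variable {n s : ℕ} {u : Fin s → Fin 3 → ℂ} {v : Fin s → Fin (n + 1) → ℂ} {z : Fin (n + 1) → ℂ}

/-- The `V`-coordinates of the extended configuration. -/
def extU (u : Fin s → Fin 3 → ℂ) : Fin s ⊕ Fin 3 → Fin 3 → ℂ :=
  Sum.elim u fun c => Pi.single c 1

/-- The `W`-coordinates of the extended configuration. -/
def extV (v : Fin s → Fin (n + 1) → ℂ) (z : Fin (n + 1) → ℂ) : Fin s ⊕ Fin 3 → Fin (n + 3) → ℂ :=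
  Sum.elim (fun i => planeExt (v i))
    ![Pi.single 0 1, Pi.single 1 1, Pi.single 0 1 + Pi.single 1 1 + planeExt z]

theorem restrict_mem_dualAnnihilator {ℓ : Module.Dual ℂ (Idx 2 (n + 2) → ℂ)}
    (h : ℓ ∈ (⨆ i, tangentCone (m := 2) (extU u i) (extV v z i)).dualAnnihilator) :
    ℓ ∘ₗ tensorExt 2 n ∈ (⨆ i, tangentCone (m := 2) (u i) (v i)).dualAnnihilator := by
  rw [mem_dualAnnihilator_iSup_tangentCone] at h ⊢
  intro i
  have hf : ∀ a x y, form (ℓ ∘ₗ tensorExt 2 n) a x y = form ℓ a (planeExt x) (planeExt y) := by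
    intro a x y
    rw [form, LinearMap.comp_apply, tensorExt_tens, form]
  refine mem_dualAnnihilator_tangentCone _ (fun a => ?_) (fun w => ?_)
  · rw [hf]; exact form_tangentCone_left ℓ (h (Sum.inl i)) a
  · rw [hf]; exact form_tangentCone_right ℓ (h (Sum.inl i)) _

/-- The three new points are `(ε₀, e)`, `(ε₁, f)`, `(ε₂, e + f + z)`. Their tangent conditions
express all values of the form through the three linear forms of `extData` and make each of these
vanish at `z`. An old point `(uᵢ, vᵢ)`, paired with `e` and with `f`, contributes the two remaining
kinds of conditions. -/
theorem extension_kernel {ℓ : Module.Dual ℂ (Idx 2 (n + 2) → ℂ)}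
    (h : ℓ ∈ (⨆ i, tangentCone (m := 2) (extU u i) (extV v z i)).dualAnnihilator)
    (h0 : ℓ ∘ₗ tensorExt 2 n = 0) :
    extData n ℓ ∈ (Submodule.span ℂ (Set.range (extConditions u v z))).dualAnnihilator ∧
      (extData n ℓ = 0 → ℓ = 0) := by
  rw [mem_dualAnnihilator_iSup_tangentCone] at h
  set e : Fin (n + 3) → ℂ := Pi.single 0 1 with he
  set f : Fin (n + 3) → ℂ := Pi.single 1 1 with hf
  have hUU : ∀ a x y, form ℓ a (planeExt x) (planeExt y) = 0 := by
    intro a x y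
    rw [form, ← tensorExt_tens, ← LinearMap.comp_apply, h0, LinearMap.zero_apply]
  have hee : ∀ a, form ℓ a e e = 0 := fun a => form_tangentCone_left ℓ (h (Sum.inr 0)) a
  have hff : ∀ a, form ℓ a f f = 0 := fun a => form_tangentCone_left ℓ (h (Sum.inr 1)) a
  have hgg : ∀ a, form ℓ a (e + f + planeExt z) (e + f + planeExt z) = 0 :=
    fun a => form_tangentCone_left ℓ (h (Sum.inr 2)) a
  have h0e : ∀ w, form ℓ (Pi.single 0 1) e w = 0 := fun w => form_tangentCone_right ℓ (h (Sum.inr 0)) w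
  have h1f : ∀ w, form ℓ (Pi.single 1 1) f w = 0 := fun w => form_tangentCone_right ℓ (h (Sum.inr 1)) w
  have h2g : ∀ w, form ℓ (Pi.single 2 1) (e + f + planeExt z) w = 0 :=
    fun w => form_tangentCone_right ℓ (h (Sum.inr 2)) w
  have hui : ∀ i w, form ℓ (u i) (planeExt (v i)) w = 0 :=
    fun i w => form_tangentCone_right ℓ (h (Sum.inl i)) w
  -- the symmetric sum of the two mixed forms
  have hef : ∀ a, form ℓ a e f + form ℓ a e (planeExt z) + form ℓ a f (planeExt z) = 0 := by
    intro a
    have := hgg a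
    simp only [form_add_mid, form_add_right, hee, hff, hUU] at this
    rw [form_comm ℓ a f e, form_comm ℓ a (planeExt z) e, form_comm ℓ a (planeExt z) f] at this
    linear_combination this / 2
  have h2x : ∀ x, form ℓ (Pi.single 2 1) e (planeExt x) + form ℓ (Pi.single 2 1) f (planeExt x) = 0 := by
    intro x
    have := h2g (planeExt x)
    simpa only [form_add_mid, hUU, add_zero] using this
  have hz : ∀ c, extData n ℓ (block c z) = 0 := by
    intro c
    rw [extData_block]
    have a0 := hef (Pi.single 0 1)
    have a1 := hef (Pi.single 1 1)
    rw [h0e, h0e] at a0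
    rw [form_comm ℓ _ e f, h1f, h1f] at a1
    have b1 := h2g e
    have b2 := h2g f
    simp only [form_add_mid, hee, hff] at b1 b2
    rw [form_comm ℓ _ f e, form_comm ℓ _ (planeExt z) e] at b1
    rw [form_comm ℓ _ (planeExt z) f] at b2
    -- For `ε₂` the pairings of `ef`, `ez`, `fz` have vanishing pairwise sums, so each is zero.
    have b3 := h2x z
    fin_cases c
    · change form ℓ (Pi.single 1 1) e (planeExt z) = 0
      linear_combination a1
    · change form ℓ (Pi.single 2 1) e (planeExt z) = 0
      linear_combination (b1 - b2 + b3) / 2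
    · change form ℓ (Pi.single 0 1) f (planeExt z) = 0
      linear_combination a0
  have hE : ∀ a x, form ℓ a e (planeExt x) =
      a 1 * extData n ℓ (block 0 x) + a 2 * extData n ℓ (block 1 x) := by
    intro a x
    rw [form_decomp, h0e, extData_block, extData_block]
    change _ = a 1 * form ℓ (Pi.single 1 1) e (planeExt x) + a 2 * form ℓ (Pi.single 2 1) e (planeExt x)
    ring
  have hF : ∀ a x, form ℓ a f (planeExt x) =
      a 0 * extData n ℓ (block 2 x) - a 2 * extData n ℓ (block 1 x) := by
    intro a x
    rw [form_decomp, h1f, extData_block, extData_block]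
    change _ = a 0 * form ℓ (Pi.single 0 1) f (planeExt x) - a 2 * form ℓ (Pi.single 2 1) e (planeExt x)
    linear_combination a 2 * h2x x
  constructor
  · rw [Submodule.mem_dualAnnihilator]
    intro w hw
    refine Submodule.span_induction ?_ (map_zero _)
      (fun x y _ _ hx hy => by rw [map_add, hx, hy, add_zero])
      (fun c x _ hx => by rw [map_smul, hx, smul_zero]) hw
    rintro _ ⟨c | i | i, rfl⟩
    · exact hz c
    · have := hui i e
      rw [form_comm, hE] at this
      simpa [extConditions] using this
    · have := hui i f
      rw [form_comm, hF] at this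
      simpa [extConditions] using this
  · intro hd
    have hE' : ∀ a x, form ℓ a e (planeExt x) = 0 := by intro a x; rw [hE, hd]; simp
    have hF' : ∀ a x, form ℓ a f (planeExt x) = 0 := by intro a x; rw [hF, hd]; simp
    -- The value on `ef` is tied to those on `ez` and `fz` by vanishing on the square of the third
    -- point.
    have hef' : ∀ a, form ℓ a e f = 0 := by
      intro a
      have := hef a
      rwa [hE', hF', add_zero, add_zero] at this
    refine eq_zero_of_form_eq_zero ℓ fun a w w' => ?_
    rw [eq_planeExt w, eq_planeExt w', ← he, ← hf]
    simp only [form_add_mid, form_add_right, form_smul_mid, form_smul_right, hee, hff, hUU, hE', hF',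
      hef', form_comm ℓ a f e, form_comm ℓ a (planeExt _) e, form_comm ℓ a (planeExt _) f]
    ring

/-- Rank-nullity for restriction to `V ⊗ S₂(ℂ^{n+1})`, whose kernel embeds into the solutions of
`extConditions` through `extData`. -/
theorem finrank_dualAnnihilator_extension_le :
    Module.finrank ℂ (⨆ i, tangentCone (m := 2) (extU u i) (extV v z i)).dualAnnihilator ≤
      Module.finrank ℂ (⨆ i, tangentCone (m := 2) (u i) (v i)).dualAnnihilator +
      Module.finrank ℂ (Submodule.span ℂ (Set.range (extConditions u v z))).dualAnnihilator := by
  set N := (⨆ i, tangentCone (m := 2) (extU u i) (extV v z i)).dualAnnihilator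
  let r : N →ₗ[ℂ] (⨆ i, tangentCone (m := 2) (u i) (v i)).dualAnnihilator :=
    LinearMap.restrict (LinearMap.lcomp ℂ ℂ (tensorExt 2 n)) fun ℓ h => restrict_mem_dualAnnihilator h
  rw [← LinearMap.finrank_range_add_finrank_ker r]
  refine add_le_add (Submodule.finrank_le _) ?_
  have hk : ∀ x : LinearMap.ker r, (x : N).1 ∘ₗ tensorExt 2 n = 0 := fun x =>
    congrArg Subtype.val (LinearMap.mem_ker.1 x.2)
  let g : LinearMap.ker r →ₗ[ℂ]
      (Submodule.span ℂ (Set.range (extConditions u v z))).dualAnnihilator :=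
    LinearMap.codRestrict _ (extData n ∘ₗ N.subtype ∘ₗ (LinearMap.ker r).subtype)
      fun x => (extension_kernel x.1.2 (hk x)).1
  refine LinearMap.finrank_le_finrank_of_injective (f := g) ?_
  rw [injective_iff_map_eq_zero]
  intro x hx
  exact Subtype.ext (Subtype.ext ((extension_kernel x.1.2 (hk x)).2 (congrArg Subtype.val hx)))

end kernel

/-! ### Special positions for the points of `ℂ^{n+1}` -/

section special

variable {n : ℕ} {σ : Type} {u : σ → Fin 3 → ℂ} {v : σ → Fin (n + 1) → ℂ} {z : Fin (n + 1) → ℂ}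

theorem block_mem_extConditions (c : Fin 3) :
    block c z ∈ Submodule.span ℂ (Set.range (extConditions u v z)) :=
  Submodule.subset_span ⟨Sum.inl c, rfl⟩

theorem extConditions_mem_left (i : σ) : u i 1 • block 0 (v i) + u i 2 • block 1 (v i) ∈
    Submodule.span ℂ (Set.range (extConditions u v z)) :=
  Submodule.subset_span ⟨Sum.inr (Sum.inl i), rfl⟩

theorem extConditions_mem_right (i : σ) : u i 0 • block 2 (v i) - u i 2 • block 1 (v i) ∈
    Submodule.span ℂ (Set.range (extConditions u v z)) :=
  Submodule.subset_span ⟨Sum.inr (Sum.inr i), rfl⟩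

/-- When one coordinate of `uᵢ` is 0 and the others are 1, the two conditions decouple into `vᵢ`
placed in two of the three blocks. The three choices of zero coordinate give the three pairs of
blocks. -/
theorem block_mem_of_eq_zero_one_one {i : σ} (h : u i = ![0, 1, 1]) :
    block 0 (v i) ∈ Submodule.span ℂ (Set.range (extConditions u v z)) ∧
      block 1 (v i) ∈ Submodule.span ℂ (Set.range (extConditions u v z)) := by
  have h1 := extConditions_mem_left (u := u) (v := v) (z := z) i
  have h2 := extConditions_mem_right (u := u) (v := v) (z := z) i
  rw [h] at h1 h2
  simp only [Matrix.cons_val, one_smul, zero_smul, zero_sub, Submodule.neg_mem_iff] at h1 h2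
  exact ⟨(Submodule.add_mem_iff_left _ h2).1 h1, h2⟩

theorem block_mem_of_eq_one_one_zero {i : σ} (h : u i = ![1, 1, 0]) :
    block 0 (v i) ∈ Submodule.span ℂ (Set.range (extConditions u v z)) ∧
      block 2 (v i) ∈ Submodule.span ℂ (Set.range (extConditions u v z)) := by
  have h1 := extConditions_mem_left (u := u) (v := v) (z := z) i
  have h2 := extConditions_mem_right (u := u) (v := v) (z := z) i
  rw [h] at h1 h2
  simp only [Matrix.cons_val, one_smul, zero_smul, sub_zero, add_zero] at h1 h2
  exact ⟨h1, h2⟩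

theorem block_mem_of_eq_one_zero_one {i : σ} (h : u i = ![1, 0, 1]) :
    block 1 (v i) ∈ Submodule.span ℂ (Set.range (extConditions u v z)) ∧
      block 2 (v i) ∈ Submodule.span ℂ (Set.range (extConditions u v z)) := by
  have h1 := extConditions_mem_left (u := u) (v := v) (z := z) i
  have h2 := extConditions_mem_right (u := u) (v := v) (z := z) i
  rw [h] at h1 h2
  simp only [Matrix.cons_val, one_smul, zero_smul, zero_add] at h1 h2
  exact ⟨h1, (Submodule.sub_mem_iff_left _ h1).1 h2⟩

theorem block_single {n : ℕ} (c : Fin 3) (j : Fin (n + 1)) :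
    block c (Pi.single j 1) = (Pi.single (c, j) 1 : Fin 3 × Fin (n + 1) → ℂ) := by
  ext ⟨c', j'⟩
  by_cases h : c' = c <;> simp [block, h, Pi.single_apply]

theorem eq_top_of_block_mem (S : Submodule ℂ (Fin 3 × Fin (n + 1) → ℂ))
    (h : ∀ c j, block c (Pi.single j 1) ∈ S) : S = ⊤ := by
  rw [eq_top_iff]
  intro x _
  refine pi_mem_span_of_linear S LinearMap.id (fun p => ?_) x
  rw [LinearMap.id_apply, ← block_single]
  exact h _ _

theorem block_mem_of_add_mem {S : Submodule ℂ (Fin 3 × Fin (n + 1) → ℂ)} {c : Fin 3}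
    {x y : Fin (n + 1) → ℂ} (h : block c (x + y) ∈ S) : block c x ∈ S ↔ block c y ∈ S := by
  rw [map_add] at h
  exact ⟨fun hx => (Submodule.add_mem_iff_right _ hx).1 h,
    fun hy => (Submodule.add_mem_iff_left _ hy).1 h⟩

end special

/-- The conditions imposed by suitable `s` points of `ℂ^{n+1}` and three further points have corank
at most `d`. -/
def ExtCorankLE (n s d : ℕ) : Prop :=
  ∃ (u : Fin s → Fin 3 → ℂ) (v : Fin s → Fin (n + 1) → ℂ) (z : Fin (n + 1) → ℂ),
    3 * (n + 1) ≤ Module.finrank ℂ (Submodule.span ℂ (Set.range (extConditions u v z))) + d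

theorem extCorankLE_of_equiv {n s d : ℕ} {σ : Type} (e : Fin s ≃ σ) (u : σ → Fin 3 → ℂ)
    (v : σ → Fin (n + 1) → ℂ) (z : Fin (n + 1) → ℂ)
    (h : 3 * (n + 1) ≤ Module.finrank ℂ (Submodule.span ℂ (Set.range (extConditions u v z))) + d) :
    ExtCorankLE n s d := by
  refine ⟨u ∘ e, v ∘ e, z, ?_⟩
  have : extConditions (u ∘ e) (v ∘ e) z =
      extConditions u v z ∘ Equiv.sumCongr (Equiv.refl _) (Equiv.sumCongr e e) := by
    ext (c | i | i) : 1 <;> rfl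
  rwa [this, EquivLike.range_comp]

theorem ExtCorankLE.succ {n s d : ℕ} (h : ExtCorankLE n s d) : ExtCorankLE n (s + 1) d := by
  obtain ⟨u, v, z, h⟩ := h
  refine ⟨Fin.cons 0 u, Fin.cons 0 v, z, h.trans (Nat.add_le_add_right (Submodule.finrank_mono
    (Submodule.span_mono ?_)) d)⟩
  rintro _ ⟨c | i | i, rfl⟩
  · exact ⟨Sum.inl c, rfl⟩
  · exact ⟨Sum.inr (Sum.inl i.succ), rfl⟩
  · exact ⟨Sum.inr (Sum.inr i.succ), rfl⟩

theorem finrank_blocks (n : ℕ) : Module.finrank ℂ (Fin 3 × Fin (n + 1) → ℂ) = 3 * (n + 1) := by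
  rw [Module.finrank_fintype_fun_eq_card, Fintype.card_prod, Fintype.card_fin, Fintype.card_fin]

theorem extCorankLE_zero_of_eq_top {n s : ℕ} {σ : Type} (e : Fin s ≃ σ) (u : σ → Fin 3 → ℂ)
    (v : σ → Fin (n + 1) → ℂ) (z : Fin (n + 1) → ℂ)
    (h : ∀ c j, block c (Pi.single j 1) ∈ Submodule.span ℂ (Set.range (extConditions u v z))) :
    ExtCorankLE n s 0 := by
  refine extCorankLE_of_equiv e u v z ?_
  rw [eq_top_of_block_mem _ h, finrank_top, finrank_blocks, add_zero]

/-- Group `2p` basis vectors into pairs `(x, y)`. Placing `x` in blocks 0 and 1, `y` in 0 and 2, `x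
+ y` in 1 and 2 spans all six dimensions of a pair; `z` supplies the remaining basis vector in every
block. -/
theorem extCorankLE_even (p : ℕ) : ExtCorankLE (2 * p) (3 * p) 0 := by
  let x : Fin p → Fin (2 * p + 1) → ℂ := fun i => Pi.single ⟨i, by omega⟩ 1
  let y : Fin p → Fin (2 * p + 1) → ℂ := fun i => Pi.single ⟨p + i, by omega⟩ 1
  let z : Fin (2 * p + 1) → ℂ := Pi.single ⟨2 * p, by omega⟩ 1
  let u : Fin p ⊕ Fin p ⊕ Fin p → Fin 3 → ℂ :=
    Sum.elim (fun _ => ![0, 1, 1]) (Sum.elim (fun _ => ![1, 1, 0]) (fun _ => ![1, 0, 1]))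
  let v : Fin p ⊕ Fin p ⊕ Fin p → Fin (2 * p + 1) → ℂ := Sum.elim x (Sum.elim y (fun i => x i + y i))
  refine extCorankLE_zero_of_eq_top (Fintype.equivOfCardEq (by simp; ring)) u v z fun c j => ?_
  by_cases h1 : (j : ℕ) < p
  · have hj : (Pi.single j 1 : Fin (2 * p + 1) → ℂ) = x ⟨j, h1⟩ := rfl
    rw [hj]
    have hab := block_mem_of_eq_zero_one_one (u := u) (v := v) (z := z)
      (i := Sum.inl ⟨j, h1⟩) rfl
    have hac := block_mem_of_eq_one_one_zero (u := u) (v := v) (z := z)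
      (i := Sum.inr (Sum.inl ⟨j, h1⟩)) rfl
    have hbc := block_mem_of_eq_one_zero_one (u := u) (v := v) (z := z)
      (i := Sum.inr (Sum.inr ⟨j, h1⟩)) rfl
    fin_cases c
    · exact hab.1
    · exact hab.2
    · exact (block_mem_of_add_mem hbc.2).2 hac.2
  · by_cases h2 : (j : ℕ) < 2 * p
    · have hj : (Pi.single j 1 : Fin (2 * p + 1) → ℂ) = y ⟨j - p, by omega⟩ := by
        simp only [y]
        congr 1
        ext
        simp only
        omega
      rw [hj]
      have hab := block_mem_of_eq_zero_one_one (u := u) (v := v) (z := z)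
        (i := Sum.inl ⟨j - p, by omega⟩) rfl
      have hac := block_mem_of_eq_one_one_zero (u := u) (v := v) (z := z)
        (i := Sum.inr (Sum.inl ⟨j - p, by omega⟩)) rfl
      have hbc := block_mem_of_eq_one_zero_one (u := u) (v := v) (z := z)
        (i := Sum.inr (Sum.inr ⟨j - p, by omega⟩)) rfl
      fin_cases c
      · exact hac.1
      · exact (block_mem_of_add_mem hbc.1).1 hab.2
      · exact hac.2
    · have hj : (Pi.single j 1 : Fin (2 * p + 1) → ℂ) = z := by
        simp only [z]
        congr 1
        ext
        simp only
        omega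
      rw [hj]
      exact block_mem_extConditions c

/-- Here the basis consists of `p + 1` full pairs, so the points suffice and `z` may be zero. -/
theorem extCorankLE_odd (p : ℕ) : ExtCorankLE (2 * p + 1) (3 * p + 3) 0 := by
  let x : Fin (p + 1) → Fin (2 * p + 1 + 1) → ℂ := fun i => Pi.single ⟨i, by omega⟩ 1
  let y : Fin (p + 1) → Fin (2 * p + 1 + 1) → ℂ := fun i => Pi.single ⟨p + 1 + i, by omega⟩ 1
  let u : Fin (p + 1) ⊕ Fin (p + 1) ⊕ Fin (p + 1) → Fin 3 → ℂ :=
    Sum.elim (fun _ => ![0, 1, 1]) (Sum.elim (fun _ => ![1, 1, 0]) (fun _ => ![1, 0, 1]))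
  let v : Fin (p + 1) ⊕ Fin (p + 1) ⊕ Fin (p + 1) → Fin (2 * p + 1 + 1) → ℂ :=
    Sum.elim x (Sum.elim y (fun i => x i + y i))
  refine extCorankLE_zero_of_eq_top (Fintype.equivOfCardEq (by simp; ring)) u v 0 fun c j => ?_
  have hxy : ∀ (i : Fin (p + 1)) (c : Fin 3),
      block c (x i) ∈ Submodule.span ℂ (Set.range (extConditions u v 0)) ∧
      block c (y i) ∈ Submodule.span ℂ (Set.range (extConditions u v 0)) := by
    intro i c
    have hab := block_mem_of_eq_zero_one_one (u := u) (v := v) (z := 0) (i := Sum.inl i) rfl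
    have hac := block_mem_of_eq_one_one_zero (u := u) (v := v) (z := 0)
      (i := Sum.inr (Sum.inl i)) rfl
    have hbc := block_mem_of_eq_one_zero_one (u := u) (v := v) (z := 0)
      (i := Sum.inr (Sum.inr i)) rfl
    fin_cases c
    · exact ⟨hab.1, hac.1⟩
    · exact ⟨hab.2, (block_mem_of_add_mem hbc.1).1 hab.2⟩
    · exact ⟨(block_mem_of_add_mem hbc.2).2 hac.2, hac.2⟩
  by_cases h1 : (j : ℕ) < p + 1
  · exact (hxy ⟨j, h1⟩ c).1
  · have hj : (Pi.single j 1 : Fin (2 * p + 1 + 1) → ℂ) = y ⟨j - (p + 1), by omega⟩ := by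
      simp only [y]
      congr 1
      ext
      simp only
      omega
    rw [hj]
    exact (hxy _ c).2

/-- There are `3 + 2(3p+1) = 3(2p+2) - 1` conditions, so corank 1 is optimal. In the last pair `z`
gives `x` in all blocks and one point gives `x + y` in blocks 1 and 2; only `y` in block 0, the line
`L`, is missing. -/
theorem extCorankLE_odd_one (p : ℕ) : ExtCorankLE (2 * p + 1) (3 * p + 1) 1 := by
  let x : Fin (p + 1) → Fin (2 * p + 1 + 1) → ℂ := fun i => Pi.single ⟨i, by omega⟩ 1
  let y : Fin (p + 1) → Fin (2 * p + 1 + 1) → ℂ := fun i => Pi.single ⟨p + 1 + i, by omega⟩ 1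
  let u : Fin p ⊕ Fin p ⊕ Fin (p + 1) → Fin 3 → ℂ :=
    Sum.elim (fun _ => ![0, 1, 1]) (Sum.elim (fun _ => ![1, 1, 0]) (fun _ => ![1, 0, 1]))
  let v : Fin p ⊕ Fin p ⊕ Fin (p + 1) → Fin (2 * p + 1 + 1) → ℂ :=
    Sum.elim (fun i => x i.castSucc) (Sum.elim (fun i => y i.castSucc) (fun i => x i + y i))
  let z := x (Fin.last p)
  refine extCorankLE_of_equiv (Fintype.equivOfCardEq (by simp; ring)) u v z ?_
  set S := Submodule.span ℂ (Set.range (extConditions u v z))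
  set L := Submodule.span ℂ {block 0 (y (Fin.last p))}
  have hS : S ≤ S ⊔ L := le_sup_left
  have hxy : ∀ (i : Fin (p + 1)) (c : Fin 3), block c (x i) ∈ S ⊔ L ∧ block c (y i) ∈ S ⊔ L := by
    intro i c
    have hbc := block_mem_of_eq_one_zero_one (u := u) (v := v) (z := z)
      (i := Sum.inr (Sum.inr i)) rfl
    refine Fin.lastCases ?_ (fun i => ?_) i (motive := fun i =>
      block 1 (x i + y i) ∈ S ∧ block 2 (x i + y i) ∈ S →
      block c (x i) ∈ S ⊔ L ∧ block c (y i) ∈ S ⊔ L) hbc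
    · intro hbc
      have hz : ∀ c, block c (x (Fin.last p)) ∈ S := fun c => block_mem_extConditions c
      refine ⟨hS (hz c), ?_⟩
      fin_cases c
      · exact Submodule.mem_sup_right (Submodule.mem_span_singleton_self _)
      · exact hS ((block_mem_of_add_mem hbc.1).1 (hz 1))
      · exact hS ((block_mem_of_add_mem hbc.2).1 (hz 2))
    · intro hbc
      have hab := block_mem_of_eq_zero_one_one (u := u) (v := v) (z := z) (i := Sum.inl i) rfl
      have hac := block_mem_of_eq_one_one_zero (u := u) (v := v) (z := z)
        (i := Sum.inr (Sum.inl i)) rfl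
      fin_cases c
      · exact ⟨hS hab.1, hS hac.1⟩
      · exact ⟨hS hab.2, hS ((block_mem_of_add_mem hbc.1).1 hab.2)⟩
      · exact ⟨hS ((block_mem_of_add_mem hbc.2).2 hac.2), hS hac.2⟩
  have htop : S ⊔ L = ⊤ := by
    refine eq_top_of_block_mem _ fun c j => ?_
    by_cases h1 : (j : ℕ) < p + 1
    · exact (hxy ⟨j, h1⟩ c).1
    · have hj : (Pi.single j 1 : Fin (2 * p + 1 + 1) → ℂ) = y ⟨j - (p + 1), by omega⟩ := by
        simp only [y]
        congr 1
        ext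
        simp only
        omega
      rw [hj]
      exact (hxy _ c).2
  have h1 := Submodule.finrank_add_le_finrank_add_finrank S L
  rw [htop, finrank_top, finrank_blocks] at h1
  have h2 : Module.finrank ℂ L ≤ 1 := (finrank_span_le_card _).trans (by simp)
  omega

/-! ### The induction -/

/-- Suitable `s` tangent spaces to `X 2 n` span a subspace of codimension at most `d`. -/
def TangentCorankLE (n s d : ℕ) : Prop :=
  ∃ (u : Fin s → Fin 3 → ℂ) (v : Fin s → Fin (n + 1) → ℂ),
    3 * (n + 2).choose 2 ≤ Module.finrank ℂ ↥(⨆ i, tangentCone (m := 2) (u i) (v i)) + d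

/-- The conditions `extConditions` as polynomials in the coordinates of the points. -/
def extConditionsPoly {n : ℕ} (s : ℕ) (z : Fin (n + 1) → ℂ) :
    Matrix (Fin 3 ⊕ Fin s ⊕ Fin s) (Fin 3 × Fin (n + 1)) (MvPolynomial (Param 2 n s) ℂ) :=
  Matrix.of <| Sum.elim (fun c p => MvPolynomial.C (block c z p)) (Sum.elim
    (fun i p => MvPolynomial.X (i, Sum.inr p.2) *
      ![MvPolynomial.X (i, Sum.inl 1), MvPolynomial.X (i, Sum.inl 2), 0] p.1)
    (fun i p => MvPolynomial.X (i, Sum.inr p.2) *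
      ![0, -MvPolynomial.X (i, Sum.inl 2), MvPolynomial.X (i, Sum.inl 0)] p.1))

theorem row_extConditionsPoly {n s : ℕ} (u : Fin s → Fin 3 → ℂ) (v : Fin s → Fin (n + 1) → ℂ)
    (z : Fin (n + 1) → ℂ) :
    ((extConditionsPoly s z).map (MvPolynomial.eval (paramPoint (m := 2) u v))).row =
      extConditions u v z := by
  ext (c | i | i) ⟨c', j⟩
  · simp [extConditionsPoly, extConditions]
  · fin_cases c' <;> simp [extConditionsPoly, extConditions, block, paramPoint, mul_comm]
  · fin_cases c' <;> simp [extConditionsPoly, extConditions, block, paramPoint, mul_comm]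

/-- The hypotheses may be witnessed by different points, but both are open conditions, so one choice
satisfies both. Then the dimensions of the annihilators add. -/
theorem TangentCorankLE.step {n s d e : ℕ} (h : TangentCorankLE n s d) (h' : ExtCorankLE n s e) :
    TangentCorankLE (n + 2) (s + 3) (d + e) := by
  obtain ⟨u₁, v₁, h₁⟩ := h
  obtain ⟨u₂, v₂, z, h₂⟩ := h'
  rw [← span_jacobian] at h₁
  rw [← row_extConditionsPoly] at h₂
  obtain ⟨F₁, hF₁, hF₁'⟩ := exists_ne_zero_le_finrank_span (jacobian 2 n s) _ _ le_rfl
  obtain ⟨F₂, hF₂, hF₂'⟩ := exists_ne_zero_le_finrank_span (extConditionsPoly s z) _ _ le_rfl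
  obtain ⟨x, hx⟩ : ∃ x, MvPolynomial.eval x (F₁ * F₂) ≠ 0 := by
    by_contra! hc
    exact mul_ne_zero hF₁ hF₂ (MvPolynomial.funext fun x => by rw [hc x, map_zero])
  rw [map_mul] at hx
  have g₁ := h₁.trans (Nat.add_le_add_right (hF₁' x (left_ne_zero_of_mul hx)) d)
  have g₂ := h₂.trans (Nat.add_le_add_right (hF₂' x (right_ne_zero_of_mul hx)) e)
  rw [← paramPoint_coords x] at g₁ g₂
  set u : Fin s → Fin 3 → ℂ := fun i a => x (i, Sum.inl a)
  set v : Fin s → Fin (n + 1) → ℂ := fun i a => x (i, Sum.inr a)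
  rw [span_jacobian] at g₁
  rw [row_extConditionsPoly] at g₂
  have key := finrank_dualAnnihilator_extension_le (u := u) (v := v) (z := z)
  have d₁ := Subspace.finrank_add_finrank_dualAnnihilator_eq
    (⨆ i, tangentCone (m := 2) (u i) (v i))
  have d₂ := Subspace.finrank_add_finrank_dualAnnihilator_eq
    (Submodule.span ℂ (Set.range (extConditions u v z)))
  have d₃ := Subspace.finrank_add_finrank_dualAnnihilator_eq
    (⨆ i, tangentCone (m := 2) (extU u i) (extV v z i))
  rw [Module.finrank_fintype_fun_eq_card, card_idx] at d₁ d₃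
  rw [finrank_blocks] at d₂
  refine ⟨extU u ∘ finSumFinEquiv.symm, extV v z ∘ finSumFinEquiv.symm, ?_⟩
  have hre : (⨆ i, tangentCone (m := 2) ((extU u ∘ finSumFinEquiv.symm) i)
      ((extV v z ∘ finSumFinEquiv.symm) i)) = ⨆ i, tangentCone (m := 2) (extU u i) (extV v z i) :=
    finSumFinEquiv.symm.iSup_comp (g := fun i => tangentCone (m := 2) (extU u i) (extV v z i))
  rw [hre]
  omega

/-! ### Small cases -/

theorem tens_symMul_mem_iSup {m n s : ℕ} {u : Fin s → Fin (m + 1) → ℂ}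
    {v : Fin s → Fin (n + 1) → ℂ} (i : Fin s) (a : Fin (m + 1) → ℂ) :
    tens a (symMul (v i) (v i)) ∈ ⨆ i, tangentCone (u i) (v i) :=
  Submodule.mem_iSup_of_mem i (tens_mem_tangentCone_left _ _ _)

theorem tens_symMul_mem_iSup_right {m n s : ℕ} {u : Fin s → Fin (m + 1) → ℂ}
    {v : Fin s → Fin (n + 1) → ℂ} (i : Fin s) (w : Fin (n + 1) → ℂ) :
    tens (u i) (symMul (v i) w) ∈ ⨆ i, tangentCone (u i) (v i) :=
  Submodule.mem_iSup_of_mem i (tens_mem_tangentCone_right _ _ _)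

theorem tangentCorankLE_zero_of_mem {n s : ℕ} (u : Fin s → Fin 3 → ℂ) (v : Fin s → Fin (n + 1) → ℂ)
    (h : ∀ a j k, tens (Pi.single a 1) (symMul (Pi.single j 1) (Pi.single k 1)) ∈
      ⨆ i, tangentCone (m := 2) (u i) (v i)) : TangentCorankLE n s 0 := by
  refine ⟨u, v, ?_⟩
  rw [eq_top_of_tens_mem _ h, finrank_top, Module.finrank_fintype_fun_eq_card, card_idx, add_zero]

theorem tangentCorankLE_zero_one : TangentCorankLE 0 1 0 := by
  refine tangentCorankLE_zero_of_mem (fun _ => 0) (fun _ => Pi.single 0 1) fun a j k => ?_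
  obtain rfl : j = 0 := Fin.fin_one_eq_zero j
  obtain rfl : k = 0 := Fin.fin_one_eq_zero k
  exact tens_symMul_mem_iSup (m := 2) (v := fun _ : Fin 1 => Pi.single 0 1) 0 _

theorem tangentCorankLE_one_three : TangentCorankLE 1 3 0 := by
  let v : Fin 3 → Fin (1 + 1) → ℂ := ![Pi.single 0 1, Pi.single 1 1, Pi.single 0 1 + Pi.single 1 1]
  refine tangentCorankLE_zero_of_mem (fun _ => 0) v fun a j k => ?_
  have h0 := tens_symMul_mem_iSup (m := 2) (u := fun _ => 0) (v := v) 0 (Pi.single a 1)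
  have h1 := tens_symMul_mem_iSup (m := 2) (u := fun _ => 0) (v := v) 1 (Pi.single a 1)
  have h2 := tens_symMul_mem_iSup (m := 2) (u := fun _ => 0) (v := v) 2 (Pi.single a 1)
  -- Polarisation: the squares of `e`, `f`, `e + f` already span `S₂(ℂ²)`, so `u` plays no role.
  have h3 := Submodule.smul_mem _ (2⁻¹ : ℂ) (Submodule.sub_mem _ (Submodule.sub_mem _ h2 h0) h1)
  have h4 : (2⁻¹ : ℂ) • (tens (m := 2) (Pi.single a 1) (symMul (v 2) (v 2)) -
      tens (Pi.single a 1) (symMul (v 0) (v 0)) - tens (Pi.single a 1) (symMul (v 1) (v 1))) =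
      tens (Pi.single a 1) (symMul (Pi.single 0 1) (Pi.single 1 1)) := by
    change (2⁻¹ : ℂ) • (tens (m := 2) (Pi.single a 1) (symMul (Pi.single 0 1 + Pi.single 1 1)
      (Pi.single 0 1 + Pi.single 1 1)) - tens (Pi.single a 1) (symMul (Pi.single 0 1) (Pi.single 0 1)) -
      tens (Pi.single a 1) (symMul (Pi.single 1 1) (Pi.single 1 1))) = _
    simp only [symMul_add_left, symMul_add_right, tens_add_right,
      symMul_comm (Pi.single 1 1) (Pi.single 0 1)]
    module
  rw [h4] at h3
  fin_cases j <;> fin_cases k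
  · exact h0
  · exact h3
  · rw [symMul_comm]; exact h3
  · exact h1

/-- Two points give 8 of the 9 dimensions, missing only `ε₂ ⊗ ef`. This includes `(n, s) = (1, 2)`,
the non-defective `k = 0` member of the exceptional family. -/
theorem T_two_one_of_le {s : ℕ} (hs : s ≤ 2) : T 2 1 s := by
  let u : Fin 2 → Fin (2 + 1) → ℂ := ![Pi.single 0 1, Pi.single 1 1]
  let v : Fin 2 → Fin (1 + 1) → ℂ := ![Pi.single 0 1, Pi.single 1 1]
  refine T_of_le u v ?_ hs
  set S := ⨆ i, tangentCone (u i) (v i) with hS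
  set L : Submodule ℂ (Idx 2 1 → ℂ) :=
    Submodule.span ℂ {tens (Pi.single 2 1) (symMul (Pi.single 0 1) (Pi.single 1 1))}
  have hef : ∀ a : Fin 3, tens (Pi.single a 1) (symMul (Pi.single 0 1) (Pi.single 1 1)) ∈ S ⊔ L := by
    intro a
    fin_cases a
    · exact Submodule.mem_sup_left (tens_symMul_mem_iSup_right (u := u) (v := v) 0 (Pi.single 1 1))
    · refine Submodule.mem_sup_left ?_
      rw [symMul_comm]
      exact tens_symMul_mem_iSup_right (u := u) (v := v) 1 (Pi.single 0 1)
    · exact Submodule.mem_sup_right (Submodule.mem_span_singleton_self _)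
  have htop : S ⊔ L = ⊤ := by
    refine eq_top_of_tens_mem _ fun a j k => ?_
    fin_cases j <;> fin_cases k
    · exact Submodule.mem_sup_left (tens_symMul_mem_iSup (u := u) (v := v) 0 _)
    · exact hef a
    · rw [symMul_comm]; exact hef a
    · exact Submodule.mem_sup_left (tens_symMul_mem_iSup (u := u) (v := v) 1 _)
  have h1 := Submodule.finrank_add_le_finrank_add_finrank S L
  rw [htop, finrank_top, Module.finrank_fintype_fun_eq_card, card_idx] at h1
  have h2 : Module.finrank ℂ L ≤ 1 := (finrank_span_le_card _).trans (by simp)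
  have h3 : (2 + 1) * (1 + 2).choose 2 = 9 := rfl
  omega

theorem tangentCorankLE_one_one : TangentCorankLE 1 1 5 := by
  obtain ⟨u, v, h⟩ := exists_of_T (T_two_one_of_le (s := 1) one_le_two)
  refine ⟨u, v, ?_⟩
  rw [h]
  decide

/-! ### The case `m = 2` -/

/-- The bound 3 means independence: `3(k+1)(2k+1) - 3k(2k+3) = 3`. -/
theorem tangentCorankLE_even (k : ℕ) : TangentCorankLE (2 * k) (3 * k) 3 := by
  induction k with
  | zero => exact ⟨fun _ => 0, fun _ => 0, by simp⟩
  | succ k ih => exact ih.step (extCorankLE_even k)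

theorem tangentCorankLE_even_zero (k : ℕ) : TangentCorankLE (2 * k) (3 * k + 1) 0 := by
  induction k with
  | zero => exact tangentCorankLE_zero_one
  | succ k ih => exact ih.step (extCorankLE_even k).succ

/-- Again `k + 5` is the corank of independent tangent cones, `3(k+1)(2k+3) - (3k+1)(2k+4)`; each
step raises it by one. -/
theorem tangentCorankLE_odd (k : ℕ) : TangentCorankLE (2 * k + 1) (3 * k + 1) (k + 5) := by
  induction k with
  | zero => exact tangentCorankLE_one_one
  | succ k ih =>
    rw [show k + 1 + 5 = k + 5 + 1 by ring]
    exact ih.step (extCorankLE_odd_one k)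

theorem tangentCorankLE_odd_zero (k : ℕ) : TangentCorankLE (2 * k + 1) (3 * k + 3) 0 := by
  induction k with
  | zero => exact tangentCorankLE_one_three
  | succ k ih => exact ih.step (extCorankLE_odd k)

theorem TangentCorankLE.T_of_le {n s s' d : ℕ} (h : TangentCorankLE n s d)
    (hd : s * (n + 3) + d ≤ 3 * (n + 2).choose 2) (hs : s' ≤ s) : T 2 n s' := by
  obtain ⟨u, v, h⟩ := h
  refine SegreVeronese.T_of_le u v ?_ hs
  rw [show 2 + n + 1 = n + 3 by ring]
  omega

theorem TangentCorankLE.T_of_ge {n s s' : ℕ} (h : TangentCorankLE n s 0) (hs : s ≤ s') :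
    T 2 n s' := by
  obtain ⟨u, v, h⟩ := h
  exact SegreVeronese.T_of_ge u v h hs

/-- For even `n` independence at `3k` and spanning at `3k + 1` leave no gap. For odd `n`
independence at `3k + 1` and spanning at `3k + 3` leave only `s = 3k + 2`, which is excluded unless
`k = 0`. -/
theorem T_two {n s : ℕ} (h : ¬ ∃ k : ℕ, 1 ≤ k ∧ n = 2 * k + 1 ∧ s = 3 * k + 2) : T 2 n s := by
  obtain ⟨k, rfl | rfl⟩ := n.even_or_odd'
  · rcases le_or_gt s (3 * k) with hs | hs
    · refine (tangentCorankLE_even k).T_of_le (le_of_eq ?_) hs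
      have : (2 * k + 2).choose 2 = (k + 1) * (2 * k + 1) := by
        rw [Nat.choose_two_right, show (2 * k + 2) * (2 * k + 2 - 1) = (k + 1) * (2 * k + 1) * 2 by
          rw [show 2 * k + 2 - 1 = 2 * k + 1 by omega]; ring, Nat.mul_div_cancel _ two_pos]
      rw [this]
      ring
    · exact (tangentCorankLE_even_zero k).T_of_ge hs
  · rcases le_or_gt s (3 * k + 1) with hs | hs
    · refine (tangentCorankLE_odd k).T_of_le (le_of_eq ?_) hs
      rw [choose_two_odd]
      ring
    · rcases eq_or_lt_of_le (show 3 * k + 2 ≤ s from hs) with rfl | hs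
      · obtain rfl : k = 0 := by
          by_contra hk
          exact h ⟨k, Nat.one_le_iff_ne_zero.2 hk, rfl, rfl⟩
        exact T_two_one_of_le le_rfl
      · exact (tangentCorankLE_odd_zero k).T_of_ge hs

end SegreVeronese

end

theorem mainTheorem4 :
    (∀ n s : ℕ, SegreVeronese.T 2 n s ↔ ¬ ∃ k : ℕ, 1 ≤ k ∧ n = 2 * k + 1 ∧ s = 3 * k + 2) ∧
    (∀ n s : ℕ, SegreVeronese.IsDefective 2 n s ↔
      ∃ k : ℕ, 1 ≤ k ∧ n = 2 * k + 1 ∧ s = 3 * k + 2) ∧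
    (∀ n s : ℕ, ¬ SegreVeronese.IsDefective 1 n s) := by
  have hT : ∀ n s : ℕ, SegreVeronese.T 2 n s ↔
      ¬ ∃ k : ℕ, 1 ≤ k ∧ n = 2 * k + 1 ∧ s = 3 * k + 2 := by
    refine fun n s => ⟨?_, SegreVeronese.T_two⟩
    rintro h ⟨k, hk, rfl, rfl⟩
    -- Failure of `T` is read off from defectivity, by the contrapositive of Terracini's lemma.
    exact SegreVeronese.not_isDefective_of_T h (SegreVeronese.isDefective_of_exceptional hk)
  refine ⟨hT, fun n s => ⟨fun h => ?_, ?_⟩, fun n s =>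
    SegreVeronese.not_isDefective_of_T (SegreVeronese.T_one n s)⟩
  · by_contra hk
    exact SegreVeronese.not_isDefective_of_T ((hT n s).2 hk) h
  · rintro ⟨k, hk, rfl, rfl⟩
    exact SegreVeronese.isDefective_of_exceptional hk
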